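/- **Relaxation.** For $p\in\mathbb{R}[x_1,\dots,x_n]$ with $p(0)\neq 0$, let $L_p$ be the linear form on $\mathbb{R}[x_1,\dots,x_n]$ with $L_p(1)=\deg p$ and $$-\log\frac{p(-x)}{p(0)}=\sum_{\alpha\neq 0}\frac{1}{|\alpha|}\binom{|\alpha|}{\alpha}L_p(x^\alpha)\,x^\alpha .$$ Let $M_{p,0}$ and $M_{p,k}$ ($1\le k\le n$) be the real symmetric $(n+1)\times(n+1)$ matrices obtained by applying $L_p$ entrywise to $u^{\top}u$ and to $x_k\,u^{\top}u$, where $u=(1,x_1,\dots,x_n)$, and let $S(p)=\{a\in\mathbb{R}^n : M_{p,0}+\sum_k a_kM_{p,k}\succeq 0\}$. For a vector $v$ of length $n+1$ put $D_p(v)=v^{\top}M_{p,0}v$ and $N_p(v)=v^{\top}\big(\sum_{k=1}^nM_{p,k}\big)v$, so that on the diagonal $x_1=\dots=x_n=x$ the vector $v$ gives the linear inequality $D_p(v)+xN_p(v)\ge 0$. **Eulerian polynomials.** Let $A^h_0=1$ and $A^h_n=(x_n+y_n)A^h_{n-1}+x_ny_n\sum_{i=1}^{n-1}\big(\tfrac{\partial}{\partial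 x_i}+\tfrac{\partial}{\partial y_i}\big)A^h_{n-1}$. The $n$-th multivariate Eulerian polynomial is $A_n(x_1,\dots,x_n)=A^h_n|_{y_1=\dots=y_n=1}$. The $n$-th univariate Eulerian polynomial is given by $A_0(x)=1$, $A_n(x)=(n+1)xA_{n-1}(x)+(1-x)(xA_{n-1}(x))'$. **Univariate bound.** Let $S(A_n(x))\subseteq\mathbb{R}$ be the relaxation of the univariate polynomial $A_n(x)$, and let $\mathrm{un}(n)=-1/\inf S(A_n(x))$. **Multivariate bound.** Let $n=2m$ and $p=A_n(x_1,\dots,x_n)$. For an indeterminate $Y$ put $D=D_p(Y,1,-1,\dots,-1)$ and $N=N_p(Y,1,-1,\dots,-1)$, polynomials of degree at most $2$ in $Y$, write $N'D-ND'=aY^2+bY+c$ (derivatives in $Y$), and set $$y=\frac{b+\sqrt{b^2-4ac}}{2a},\qquad v=\Big(y,\,(-2^{m-i})_{i=3}^{m},\,0,\,\tfrac12,\,(1)_{i=1}^{m}\Big)\in\mathbb{R}^{n+1},\qquad \mathrm{mult}_v(n)=\frac{N_p(v)}{D_p(v)} .$$ **Lemma (Comparison with univariate bound).** For all sufficiently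 large $m$, with $n=2m$, these quantities are well defined: $a>0$, $b^2-4ac\ge 0$, $D_p(v)>0$, $N_p(v)>0$, $\mathrm{un}(n)>0$, and $-1/\mathrm{un}(n)$ is the least element of $S(A_n(x))$. Moreover, as $m\to\infty$ along $n=2m$, $$\mathrm{mult}_v(n)-\mathrm{un}(n)\sim\frac38\left(\frac98\right)^m,$$ that is, the quotient of the two sides tends to $1$. -/

import Mathlib

open scoped Matrix

noncomputable section

namespace EulerianRelaxation

/-! ### The spectrahedral relaxation -/

/-- The power series `p(-x) / p(0)`. -/
def normalizedReflection {n : ℕ} (p : MvPolynomial (Fin n) ℝ) : MvPowerSeries (Fin n) ℝ :=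
  ((MvPolynomial.C (MvPolynomial.constantCoeff p)⁻¹ *
    MvPolynomial.aeval (fun i => -MvPolynomial.X i) p : MvPolynomial (Fin n) ℝ) :
      MvPowerSeries (Fin n) ℝ)

/-- The logarithm `∑_{k ≥ 1} (-1)^(k+1) (q - 1)^k / k` of a power series `q` with `q(0) = 1`. -/
def mvLog {n : ℕ} (q : MvPowerSeries (Fin n) ℝ) : MvPowerSeries (Fin n) ℝ :=
  (PowerSeries.log ℝ).subst (q - 1)

/-- The value of the `L`-form of `p` on the monomial `x^α`: it is `deg p` for `α = 0`, and otherwise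
it is determined by `-log (p(-x)/p(0)) = ∑_{α ≠ 0} (1/|α|) * (|α| choose α) * L_p(x^α) * x^α`. -/
def lMonomial {n : ℕ} (p : MvPolynomial (Fin n) ℝ) (α : Fin n →₀ ℕ) : ℝ :=
  if α = 0 then (p.totalDegree : ℝ)
  else (α.degree : ℝ) / (α.multinomial : ℝ) *
    MvPowerSeries.coeff α (-mvLog (normalizedReflection p))

/-- The linear form `L_p` on polynomials. -/
def lForm {n : ℕ} (p : MvPolynomial (Fin n) ℝ) : MvPolynomial (Fin n) ℝ →ₗ[ℝ] ℝ :=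
  (MvPolynomial.basisMonomials (Fin n) ℝ).constr ℝ (lMonomial p)

/-- The mold vector `(1, x₁, …, xₙ)`. -/
def moldVec (n : ℕ) : Fin (n + 1) → MvPolynomial (Fin n) ℝ :=
  Fin.cons 1 MvPolynomial.X

/-- The mold matrix `(1, x₁, …, xₙ)ᵀ (1, x₁, …, xₙ)`. -/
def moldMatrix (n : ℕ) : Matrix (Fin (n + 1)) (Fin (n + 1)) (MvPolynomial (Fin n) ℝ) :=
  Matrix.vecMulVec (moldVec n) (moldVec n)

/-- The constant coefficient matrix of the pencil of `p`. -/
def pencilConst {n : ℕ} (p : MvPolynomial (Fin n) ℝ) : Matrix (Fin (n + 1)) (Fin (n + 1)) ℝ :=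
  (moldMatrix n).map (lForm p)

/-- The coefficient matrix of `x_k` in the pencil of `p`. -/
def pencilCoeff {n : ℕ} (p : MvPolynomial (Fin n) ℝ) (k : Fin n) :
    Matrix (Fin (n + 1)) (Fin (n + 1)) ℝ :=
  ((MvPolynomial.X k : MvPolynomial (Fin n) ℝ) • moldMatrix n).map (lForm p)

/-- The pencil associated to `p`, evaluated at `a`. -/
def pencil {n : ℕ} (p : MvPolynomial (Fin n) ℝ) (a : Fin n → ℝ) :
    Matrix (Fin (n + 1)) (Fin (n + 1)) ℝ :=
  pencilConst p + ∑ k, a k • pencilCoeff p k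

/-- The spectrahedron associated to `p`. -/
def spectrahedron {n : ℕ} (p : MvPolynomial (Fin n) ℝ) : Set (Fin n → ℝ) :=
  {a | (pencil p a).PosSemidef}

/-! ### Linearization along the diagonal

On the diagonal `x₁ = ⋯ = xₙ = x` the pencil is `pencilConst p + x * ∑ₖ pencilCoeff p k`, and a
vector `v` turns positive semidefiniteness into the inequality `linD p v + x * linN p v ≥ 0`. The
entries of `v` may lie in any commutative `ℝ`-algebra, so that `v` may contain an indeterminate. -/

/-- `vᵀ M₀ v`, with `M₀` the constant coefficient of the pencil of `p`. -/
def linD {n : ℕ} {R : Type*} [CommRing R] [Algebra ℝ R] (p : MvPolynomial (Fin n) ℝ)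
    (v : Fin (n + 1) → R) : R :=
  v ⬝ᵥ ((pencilConst p).map (algebraMap ℝ R) *ᵥ v)

/-- `vᵀ (M₁ + ⋯ + Mₙ) v`, with `M₁, …, Mₙ` the linear coefficients of the pencil of `p`. -/
def linN {n : ℕ} {R : Type*} [CommRing R] [Algebra ℝ R] (p : MvPolynomial (Fin n) ℝ)
    (v : Fin (n + 1) → R) : R :=
  v ⬝ᵥ ((∑ k, pencilCoeff p k).map (algebraMap ℝ R) *ᵥ v)

/-! ### Eulerian polynomials -/

/-- The homogeneous multivariate Eulerian polynomials, in the variables `x = inl` and `y = inr`. -/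
def eulerianH : (n : ℕ) → MvPolynomial (Fin n ⊕ Fin n) ℝ
  | 0 => 1
  | n + 1 =>
    let B : MvPolynomial (Fin (n + 1) ⊕ Fin (n + 1)) ℝ :=
      MvPolynomial.rename (Sum.map Fin.castSucc Fin.castSucc) (eulerianH n)
    (MvPolynomial.X (Sum.inl (Fin.last n)) + MvPolynomial.X (Sum.inr (Fin.last n))) * B +
      MvPolynomial.X (Sum.inl (Fin.last n)) * MvPolynomial.X (Sum.inr (Fin.last n)) *
        ∑ i : Fin n, (MvPolynomial.pderiv (Sum.inl i.castSucc) B +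
          MvPolynomial.pderiv (Sum.inr i.castSucc) B)

/-- The `n`-th multivariate Eulerian polynomial: the homogeneous one at `y = (1, …, 1)`. -/
def eulerian (n : ℕ) : MvPolynomial (Fin n) ℝ :=
  MvPolynomial.aeval (Sum.elim MvPolynomial.X (fun _ => 1)) (eulerianH n)

/-- The `n`-th univariate Eulerian polynomial (of degree `n`). -/
def eulerianUni : ℕ → Polynomial ℝ
  | 0 => 1
  | n + 1 => ((n : Polynomial ℝ) + 2) * Polynomial.X * eulerianUni n +
      (1 - Polynomial.X) * Polynomial.derivative (Polynomial.X * eulerianUni n)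

/-! ### The univariate bound -/

/-- The spectrahedral relaxation of the univariate Eulerian polynomial, as a set of reals. -/
def uniRelaxation (n : ℕ) : Set ℝ :=
  {x | (fun _ : Fin 1 => x) ∈
    spectrahedron (Polynomial.aeval (MvPolynomial.X (0 : Fin 1)) (eulerianUni n))}

/-- The bound given by the univariate relaxation: `x ≥ -1 / un n` is its best lower bound for the
rightmost root, so that, the Eulerian polynomials being palindromic, `un n` is its best lower bound
for the absolute value of the leftmost root. -/
def un (n : ℕ) : ℝ := -1 / sInf (uniRelaxation n)

/-! ### The multivariate bound -/

/-- The vector `(Y, 1, -1, …, -1)` with an indeterminate first entry. -/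
def oldVec (n : ℕ) : Fin (n + 1) → Polynomial ℝ := fun k =>
  if (k : ℕ) = 0 then Polynomial.X else if (k : ℕ) = 1 then 1 else -1

/-- The polynomial `N' D - N D'` in `Y`, for the linearization of the `n`-th multivariate Eulerian
polynomial by `(Y, 1, -1, …, -1)`; it has degree at most `2`. -/
def critPoly (n : ℕ) : Polynomial ℝ :=
  Polynomial.derivative (linN (eulerian n) (oldVec n)) * linD (eulerian n) (oldVec n) -
    linN (eulerian n) (oldVec n) * Polynomial.derivative (linD (eulerian n) (oldVec n))

/-- The discriminant `b² - 4ac` of `N' D - N D' = a Y² + b Y + c`. -/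
def critDisc (n : ℕ) : ℝ :=
  (critPoly n).coeff 1 ^ 2 - 4 * (critPoly n).coeff 2 * (critPoly n).coeff 0

/-- The first entry `y = (b + √(b² - 4ac)) / (2a)`. -/
def yChoice (n : ℕ) : ℝ :=
  ((critPoly n).coeff 1 + √(critDisc n)) / (2 * (critPoly n).coeff 2)

/-- The vector `(y, (-2^(m-i))_{i=3}^m, 0, 1/2, (1)_{i=1}^m)` of length `2m + 1`, for `m ≥ 2`. -/
def newVec (m : ℕ) : Fin (2 * m + 1) → ℝ := fun k =>
  if (k : ℕ) = 0 then yChoice (2 * m)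
  else if (k : ℕ) + 2 ≤ m then -2 ^ (m - ((k : ℕ) + 2))
  else if (k : ℕ) + 1 = m then 0
  else if (k : ℕ) = m then 1 / 2
  else 1

/-- The multivariate bound `N / D` for `n = 2m`. -/
def multBound (m : ℕ) : ℝ :=
  linN (eulerian (2 * m)) (newVec m) / linD (eulerian (2 * m)) (newVec m)

end EulerianRelaxation

end

/-! Write n = 2m. The pencils involve only the values of L_p on monomials of degree at most 3, and
these are polynomials in the derivatives of p at 0 up to order 3. For the multivariate Eulerian
polynomials these derivatives are explicit combinations of powers of 2, 3/2 and 4/3. They come from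
restricting A^h to a line along which its recursion becomes ordinary differentiation
(`lineEval_eulerianH_succ`).

On the diagonal, the multivariate polynomial becomes the univariate one, so vectors (a, b, …, b) see
exactly the univariate 2×2 pencil. For large m, un(n) is therefore the larger generalized eigenvalue
λ of that pencil, and λD − N = (nλ − e₁)(a − y₀b)², where (y₀, 1) is the eigenvector
(`rayleigh_eq`).

The vector v is a perturbation (y, 1 − d) of such a vector. With s = x₁ + ⋯ + xₙ, δ = Σ dᵢxᵢ, J =
L(δ), Q = L(δs), R = L(δs²), QQ = L(δ²) and RR = L(δ²s), expansion gives N(v) − λD(v) = −(nλ − e₁)(y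
− y₀)² + 2y(λJ − Q) + 2(λQ − R) + RR − λQQ. All terms except 2(λQ − R) are o(18^m)
(`expLim_linN_sub`).

Counting i from 1, the row sums satisfy L(xᵢs) ≈ 2·4^m αᵢ and L(xᵢs²) ≈ 4·16^m αᵢ − 3·9^m βᵢ, while
λ = 2·4^m − (3/2)(9/4)^m + o(2^m) (`expLim_lam_expansion`). In λL(xᵢs) − L(xᵢs²) the 16^m terms
cancel, leaving 3·9^m(βᵢ − αᵢ) = 3·9^m((3/2)^i − (4/3)^i). Since dᵢ ≈ (2^m/4)·2^(−i) for i ≤ m and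
Σ_{i≥1} ((3/4)^i − (2/3)^i) = 3 − 2 = 1, it follows that λQ − R ~ (3/4)·18^m. Dividing 2(λQ − R) by
D(v) ~ 4·16^m gives (3/8)(9/8)^m. -/

open scoped Matrix
noncomputable section
namespace EulerianRelaxation
open MvPolynomial

/-! ### Low-degree values of the `L`-form -/

/-- First-order partial derivatives of `p` at the origin. -/
def jet₁ {σ : Type*} (p : MvPolynomial σ ℝ) (i : σ) : ℝ := constantCoeff (pderiv i p)

/-- Second-order partial derivatives of `p` at the origin. -/
def jet₂ {σ : Type*} (p : MvPolynomial σ ℝ) (i j : σ) : ℝ :=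
  constantCoeff (pderiv i (pderiv j p))

/-- Third-order partial derivatives of `p` at the origin. -/
def jet₃ {σ : Type*} (p : MvPolynomial σ ℝ) (i j k : σ) : ℝ :=
  constantCoeff (pderiv i (pderiv j (pderiv k p)))

/-- The value of the `L`-form on `x_i x_j` in terms of derivatives at the origin. -/
def quad {σ : Type*} (p : MvPolynomial σ ℝ) (i j : σ) : ℝ := jet₁ p i * jet₁ p j - jet₂ p i j

/-- The value of the `L`-form on `x_i x_j x_k` in terms of derivatives at the origin. -/
def cubic {σ : Type*} (p : MvPolynomial σ ℝ) (i j k : σ) : ℝ :=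
  jet₃ p i j k / 2 -
    (jet₁ p i * jet₂ p j k + jet₁ p j * jet₂ p i k + jet₁ p k * jet₂ p i j) / 2 +
    jet₁ p i * jet₁ p j * jet₁ p k

theorem pderiv_comm {σ : Type*} (p : MvPolynomial σ ℝ) (i j : σ) :
    pderiv i (pderiv j p) = pderiv j (pderiv i p) := by
  classical
  ext m
  simp only [coeff_pderiv, Finsupp.add_apply, Finsupp.single_apply, add_right_comm m]
  by_cases h : i = j
  · subst h; ring
  · have h' : ¬ j = i := fun e => h e.symm
    simp [h, h']; ring

theorem jet₂_comm {σ : Type*} (p : MvPolynomial σ ℝ) (i j : σ) : jet₂ p i j = jet₂ p j i := by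
  rw [jet₂, pderiv_comm, jet₂]

theorem jet₃_swap_left {σ : Type*} (p : MvPolynomial σ ℝ) (i j k : σ) :
    jet₃ p i j k = jet₃ p j i k := by
  rw [jet₃, pderiv_comm, jet₃]

theorem jet₃_swap_right {σ : Type*} (p : MvPolynomial σ ℝ) (i j k : σ) :
    jet₃ p i j k = jet₃ p i k j := by
  rw [jet₃, pderiv_comm p j k, jet₃]

theorem quad_comm {σ : Type*} (p : MvPolynomial σ ℝ) (i j : σ) : quad p i j = quad p j i := by
  rw [quad, quad, jet₂_comm]; ring

theorem cubic_swap_left {σ : Type*} (p : MvPolynomial σ ℝ) (i j k : σ) :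
    cubic p i j k = cubic p j i k := by
  rw [cubic, cubic, jet₃_swap_left, jet₂_comm p i j]; ring

theorem cubic_swap_right {σ : Type*} (p : MvPolynomial σ ℝ) (i j k : σ) :
    cubic p i j k = cubic p i k j := by
  rw [cubic, cubic, jet₃_swap_right, jet₂_comm p j k]; ring

section LogJets

variable {n : ℕ}

/-- Truncation of `log (1 + u)` at degree three. -/
def logTrunc (u : MvPolynomial (Fin n) ℝ) : MvPolynomial (Fin n) ℝ :=
  u - C (1 / 2) * u ^ 2 + C (1 / 3) * u ^ 3

/-- The power (q − 1)^d has order at least d, so only d ≤ 3 reaches coefficients of degree at most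
3, and the logarithm may be replaced by a cubic polynomial. -/
theorem coeff_mvLog (q : MvPolynomial (Fin n) ℝ) (hq : constantCoeff q = 1) (α : Fin n →₀ ℕ)
    (hα : α.degree ≤ 3) :
    MvPowerSeries.coeff α (mvLog (q : MvPowerSeries (Fin n) ℝ)) = coeff α (logTrunc (q - 1)) := by
  have hu : MvPowerSeries.constantCoeff ((q : MvPowerSeries (Fin n) ℝ) - 1) = 0 := by
    have : MvPowerSeries.constantCoeff (q : MvPowerSeries (Fin n) ℝ) = 1 := by
      rw [← hq]; rfl
    simp [this]
  have hcast : ((q : MvPowerSeries (Fin n) ℝ) - 1) =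
      ((q - 1 : MvPolynomial (Fin n) ℝ) : MvPowerSeries (Fin n) ℝ) := by
    ext m
    simp [MvPolynomial.coeff_coe, MvPolynomial.coeff_sub, MvPolynomial.coeff_one,
      MvPowerSeries.coeff_one, eq_comm]
  rw [mvLog, PowerSeries.coeff_subst (PowerSeries.HasSubst.of_constantCoeff_zero hu)]
  rw [finsum_eq_sum_of_support_subset (s := Finset.range 4)]
  · simp only [Finset.sum_range_succ, Finset.sum_range_zero, PowerSeries.coeff_log, hcast,
      ← MvPolynomial.coe_pow, MvPolynomial.coeff_coe, logTrunc, MvPolynomial.coeff_add,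
      MvPolynomial.coeff_sub, MvPolynomial.coeff_C_mul]
    norm_num
    ring
  · intro d hd
    by_contra hd'
    refine hd ?_
    have h4 : 4 ≤ d := by simpa using hd'
    have : MvPowerSeries.coeff α (((q : MvPowerSeries (Fin n) ℝ) - 1) ^ d) = 0 := by
      apply MvPowerSeries.coeff_of_lt_order
      refine lt_of_lt_of_le ?_ (MvPowerSeries.le_order_pow_of_constantCoeff_eq_zero d hu)
      exact_mod_cast lt_of_le_of_lt hα h4
    simp [this]

theorem pderiv_aeval_neg (p : MvPolynomial (Fin n) ℝ) (i : Fin n) :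
    pderiv i (aeval (fun i => -X i) p : MvPolynomial (Fin n) ℝ) =
      -aeval (fun i => -X i) (pderiv i p) := by
  induction p using MvPolynomial.induction_on with
  | C a => simp
  | add p q hp hq => simp only [map_add, hp, hq]; ring
  | mul_X p j hp =>
    by_cases h : j = i
    · subst h
      simp only [map_mul, aeval_X, pderiv_mul, hp, map_neg, pderiv_X_self, map_add, map_one]
      ring
    · simp only [map_mul, aeval_X, pderiv_mul, hp, map_neg, pderiv_X_of_ne h, map_add, map_zero]
      ring

theorem constantCoeff_aeval_neg (p : MvPolynomial (Fin n) ℝ) :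
    constantCoeff (aeval (fun i => -X i) p : MvPolynomial (Fin n) ℝ) = constantCoeff p := by
  induction p using MvPolynomial.induction_on with
  | C a => simp
  | add p q hp hq => simp only [map_add, hp, hq]
  | mul_X p j hp => simp

theorem prod_factorial_add_single (α : Fin n →₀ ℕ) (i : Fin n) :
    ∏ x, ((α + Finsupp.single i 1 : Fin n →₀ ℕ) x).factorial =
      (α i + 1) * ∏ x, (α x).factorial := by
  rw [← Finset.mul_prod_erase _ _ (Finset.mem_univ i),
    ← Finset.mul_prod_erase _ (fun x => (α x).factorial) (Finset.mem_univ i)]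
  have : ∀ x ∈ Finset.univ.erase i,
      ((α + Finsupp.single i 1 : Fin n →₀ ℕ) x).factorial = (α x).factorial := by
    intro x hx
    have : x ≠ i := Finset.ne_of_mem_erase hx
    simp [this.symm]
  rw [Finset.prod_congr rfl this]
  simp [Nat.factorial_succ, mul_assoc]

theorem prod_factorial_mul_multinomial (α : Fin n →₀ ℕ) :
    (∏ x, (α x).factorial) * α.multinomial = α.degree.factorial := by
  rw [Finsupp.multinomial_eq_of_support_subset (Finset.subset_univ _), Nat.multinomial_spec,
    Finsupp.degree_eq_sum]

/-- Turns the normalization of L_p into partial derivatives: the last factor is ∂^α f(0), so in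
degrees 1, 2, 3 the value is 1, 1, 1/2 times a derivative. -/
theorem coeff_div_multinomial (α : Fin n →₀ ℕ) (f : MvPolynomial (Fin n) ℝ) :
    (α.degree : ℝ) / (α.multinomial : ℝ) * coeff α f =
      (α.degree : ℝ) / (α.degree.factorial : ℝ) * ((∏ x, (α x).factorial : ℕ) * coeff α f) := by
  have h := prod_factorial_mul_multinomial α
  have h1 : (α.degree.factorial : ℝ) ≠ 0 := by positivity
  have h2 : (α.multinomial : ℝ) ≠ 0 := by
    intro h0
    rw [← h] at h1
    push_cast at h1
    simp [h0] at h1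
  rw [← h] at h1 ⊢
  push_cast at h1 ⊢
  field_simp

theorem jet₁_eq_coeff (f : MvPolynomial (Fin n) ℝ) (i : Fin n) :
    jet₁ f i = (∏ x, ((Finsupp.single i 1 : Fin n →₀ ℕ) x).factorial : ℕ) *
      coeff (Finsupp.single i 1) f := by
  have h := prod_factorial_add_single (0 : Fin n →₀ ℕ) i
  rw [zero_add] at h
  rw [jet₁, constantCoeff_eq, coeff_pderiv, h]
  simp

theorem jet₂_eq_coeff (f : MvPolynomial (Fin n) ℝ) (i j : Fin n) :
    jet₂ f i j =
      (∏ x, ((Finsupp.single i 1 + Finsupp.single j 1 : Fin n →₀ ℕ) x).factorial : ℕ) *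
        coeff (Finsupp.single i 1 + Finsupp.single j 1) f := by
  rw [prod_factorial_add_single, Nat.cast_mul, mul_comm (Nat.cast _), mul_assoc, jet₂]
  have := jet₁_eq_coeff (pderiv j f) i
  rw [jet₁, coeff_pderiv] at this
  rw [this]
  push_cast; ring

theorem jet₃_eq_coeff (f : MvPolynomial (Fin n) ℝ) (i j k : Fin n) :
    jet₃ f i j k =
      (∏ x, ((Finsupp.single i 1 + Finsupp.single j 1 + Finsupp.single k 1 :
        Fin n →₀ ℕ) x).factorial : ℕ) *
        coeff (Finsupp.single i 1 + Finsupp.single j 1 + Finsupp.single k 1) f := by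
  rw [prod_factorial_add_single, Nat.cast_mul, mul_comm (Nat.cast _), mul_assoc, jet₃]
  have := jet₂_eq_coeff (pderiv k f) i j
  rw [jet₂, coeff_pderiv] at this
  rw [this]
  push_cast; ring

theorem lMonomial_eq {p : MvPolynomial (Fin n) ℝ} (hp : constantCoeff p = 1)
    (α : Fin n →₀ ℕ) (h0 : α ≠ 0) (hα : α.degree ≤ 3) :
    lMonomial p α = (α.degree : ℝ) / (α.multinomial : ℝ) *
      -coeff α (logTrunc (aeval (fun i => -X i) p - 1)) := by
  rw [lMonomial, if_neg h0, normalizedReflection, hp, map_neg, coeff_mvLog _ _ _ hα]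
  · simp
  · rw [inv_one, C_1, one_mul, constantCoeff_aeval_neg, hp]

/-- The chain rule for −log p(−x) at 0. The factor 2 in the third identity offsets the 3/3! = 1/2 of
the normalization. -/
theorem jets_logTrunc {p : MvPolynomial (Fin n) ℝ} (hp : constantCoeff p = 1) (i j k : Fin n) :
    -jet₁ (logTrunc (aeval (fun i => -X i) p - 1)) i = jet₁ p i ∧
    -jet₂ (logTrunc (aeval (fun i => -X i) p - 1)) i j = quad p i j ∧
    -jet₃ (logTrunc (aeval (fun i => -X i) p - 1)) i j k = 2 * cubic p i j k := by
  simp only [jet₁, jet₂, jet₃, quad, cubic, logTrunc, map_add, map_sub, pderiv_mul,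
    pderiv_pow, pderiv_aeval_neg, map_neg, map_mul, map_pow, constantCoeff_aeval_neg, hp,
    pderiv_one, constantCoeff_C, map_one, Derivation.map_natCast]
  refine ⟨?_, ?_, ?_⟩
  · simp
  · simp [map_ofNat]; ring
  · simp [map_ofNat]; ring

theorem lForm_monomial (p : MvPolynomial (Fin n) ℝ) (α : Fin n →₀ ℕ) :
    lForm p (monomial α 1) = lMonomial p α := by
  have := (basisMonomials (Fin n) ℝ).constr_basis ℝ (lMonomial p) α
  rwa [coe_basisMonomials] at this

theorem lForm_one (p : MvPolynomial (Fin n) ℝ) : lForm p 1 = p.totalDegree := by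
  have := lForm_monomial p 0
  simpa [lMonomial] using this

theorem lForm_X {p : MvPolynomial (Fin n) ℝ} (hp : constantCoeff p = 1) (i : Fin n) :
    lForm p (X i) = jet₁ p i := by
  rw [X, lForm_monomial, lMonomial_eq hp _ (by simp) (by simp), mul_neg, coeff_div_multinomial,
    ← jet₁_eq_coeff, ← (jets_logTrunc hp i i i).1]
  simp

theorem lForm_X_mul_X {p : MvPolynomial (Fin n) ℝ} (hp : constantCoeff p = 1) (i j : Fin n) :
    lForm p (X i * X j) = quad p i j := by
  have hd : (Finsupp.single i 1 + Finsupp.single j 1 : Fin n →₀ ℕ).degree = 2 := by simp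
  rw [X, X, monomial_mul, one_mul, lForm_monomial, lMonomial_eq hp, mul_neg,
    coeff_div_multinomial, ← jet₂_eq_coeff, ← (jets_logTrunc hp i j i).2.1, hd]
  · simp [Nat.factorial]
  · intro h; rw [h] at hd; simp at hd
  · omega

theorem lForm_X_mul_X_mul_X {p : MvPolynomial (Fin n) ℝ} (hp : constantCoeff p = 1)
    (i j k : Fin n) : lForm p (X i * X j * X k) = cubic p i j k := by
  have hd : (Finsupp.single i 1 + Finsupp.single j 1 + Finsupp.single k 1 :
    Fin n →₀ ℕ).degree = 3 := by simp
  rw [X, X, X, monomial_mul, monomial_mul, one_mul, one_mul, lForm_monomial, lMonomial_eq hp,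
    mul_neg, coeff_div_multinomial, ← jet₃_eq_coeff, hd]
  · have := (jets_logTrunc hp i j k).2.2
    rw [neg_eq_iff_eq_neg] at this
    rw [this]
    norm_num [Nat.factorial]
    ring
  · intro h; rw [h] at hd; simp at hd
  · omega

/-! ### The quadratic forms of the pencil -/

theorem linD_cons {R : Type*} [CommRing R] [Algebra ℝ R] {p : MvPolynomial (Fin n) ℝ}
    (hp : constantCoeff p = 1) (y : R) (w : Fin n → R) :
    linD p (Fin.cons y w : Fin (n + 1) → R) =
      (p.totalDegree : R) * y ^ 2 + 2 * y * ∑ i, algebraMap ℝ R (jet₁ p i) * w i +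
        ∑ i, ∑ j, algebraMap ℝ R (quad p i j) * (w i * w j) := by
  simp only [linD, dotProduct, Matrix.mulVec, Fin.sum_univ_succ, Fin.cons_zero, Fin.cons_succ,
    Matrix.map_apply, pencilConst, moldMatrix, Matrix.vecMulVec_apply, moldVec, one_mul, mul_one,
    lForm_one, lForm_X hp, lForm_X_mul_X hp, map_natCast, mul_add, Finset.mul_sum,
    Finset.sum_add_distrib]
  have h1 : ∀ i, 2 * y * (algebraMap ℝ R (jet₁ p i) * w i) =
    y * (algebraMap ℝ R (jet₁ p i) * w i) + w i * (algebraMap ℝ R (jet₁ p i) * y) :=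
    fun i => by ring
  have h2 : ∀ i j, w i * (algebraMap ℝ R (quad p i j) * w j) =
    algebraMap ℝ R (quad p i j) * (w i * w j) := fun i j => by ring
  simp only [h1, h2, Finset.sum_add_distrib]
  ring

theorem linN_cons {R : Type*} [CommRing R] [Algebra ℝ R] {p : MvPolynomial (Fin n) ℝ}
    (hp : constantCoeff p = 1) (y : R) (w : Fin n → R) :
    linN p (Fin.cons y w : Fin (n + 1) → R) =
      algebraMap ℝ R (∑ k, jet₁ p k) * y ^ 2 +
        2 * y * ∑ i, algebraMap ℝ R (∑ k, quad p k i) * w i +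
        ∑ i, ∑ j, algebraMap ℝ R (∑ k, cubic p k i j) * (w i * w j) := by
  have h3 : ∀ k i j : Fin n, lForm p (X k * (X i * X j)) = cubic p k i j := fun k i j => by
    rw [← mul_assoc, lForm_X_mul_X_mul_X hp]
  simp only [linN, dotProduct, Matrix.mulVec, Fin.sum_univ_succ, Fin.cons_zero, Fin.cons_succ,
    Matrix.map_apply, Matrix.sum_apply, pencilCoeff, moldMatrix, Matrix.smul_apply, smul_eq_mul,
    Matrix.vecMulVec_apply, moldVec, one_mul, mul_one,
    lForm_X hp, lForm_X_mul_X hp, h3, mul_add, Finset.mul_sum, Finset.sum_add_distrib]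
  have h1 : ∀ i, 2 * y * (algebraMap ℝ R (∑ k, quad p k i) * w i) =
    y * (algebraMap ℝ R (∑ k, quad p k i) * w i) + w i * (algebraMap ℝ R (∑ k, quad p k i) * y) :=
    fun i => by ring
  have h2 : ∀ i j, w i * (algebraMap ℝ R (∑ k, cubic p k i j) * w j) =
    algebraMap ℝ R (∑ k, cubic p k i j) * (w i * w j) := fun i j => by ring
  simp only [h1, h2, Finset.sum_add_distrib]
  ring

end LogJets
end EulerianRelaxation
end

/-! ### The linear recursion and the resulting 3-jets of the Eulerian polynomials. -/

open scoped Matrix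
noncomputable section
namespace EulerianRelaxation
open MvPolynomial

/-! ### A linear recursion for the multivariate Eulerian polynomials -/

/-- Taylor coefficients of `(1 - w)⁻² A^h_n` along the line `x = w / (1 - w) + ξ`,
`y = 1 / (1 - w)`. -/
def eulerSeq {R : Type*} [CommRing R] (ξ : ℕ → R) : ℕ → ℕ → R
  | 0, k => k + 1
  | n + 1, k => (k + 1) * ((1 - ξ n) * eulerSeq ξ n k + ξ n * eulerSeq ξ n (k + 1))

section Line

variable {R : Type*} [CommRing R] [Algebra ℝ R]

/-- The geometric series `1 / (1 - w)`. -/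
def geom (R : Type*) [CommRing R] : PowerSeries R := PowerSeries.mk 1

theorem geom_mul (R : Type*) [CommRing R] : geom R * (1 - PowerSeries.X) = 1 :=
  PowerSeries.mk_one_mul_one_sub_eq_one R

theorem derivative_geom (R : Type*) [CommRing R] :
    PowerSeries.derivative R (geom R) = geom R ^ 2 := by
  have h := congrArg (PowerSeries.derivative R) (geom_mul R)
  simp only [Derivation.leibniz, map_sub, Derivation.map_one_eq_zero, PowerSeries.derivative_X,
    smul_eq_mul] at h
  have h2 := geom_mul R
  linear_combination geom R * h - PowerSeries.derivative R (geom R) * h2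

/-- Restriction to the line `x = w / (1 - w) + ξ`, `y = 1 / (1 - w)`. -/
def lineEval (ξ : ℕ → R) (n : ℕ) : MvPolynomial (Fin n ⊕ Fin n) ℝ →ₐ[ℝ] PowerSeries R :=
  aeval (Sum.elim (fun i => geom R - 1 + PowerSeries.C (ξ i)) (fun _ => geom R))

/-- All xᵢ and yᵢ move with the same velocity (1 − w)⁻², so d/dw is this multiple of Σ(∂/∂xᵢ +
∂/∂yᵢ), the operator in the Eulerian recursion. -/
theorem derivative_lineEval (ξ : ℕ → R) (n : ℕ) (f : MvPolynomial (Fin n ⊕ Fin n) ℝ) :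
    PowerSeries.derivative R (lineEval ξ n f) =
      geom R ^ 2 * lineEval ξ n (∑ i, (pderiv (Sum.inl i) f + pderiv (Sum.inr i) f)) := by
  induction f using MvPolynomial.induction_on with
  | C a =>
    have : lineEval ξ n (C a) = PowerSeries.C (algebraMap ℝ R a) := by
      simp [lineEval, PowerSeries.algebraMap_apply]
    rw [this, PowerSeries.derivative_C]
    simp
  | add p q hp hq =>
    simp only [map_add, hp, hq, Finset.sum_add_distrib]
    ring
  | mul_X p v hp =>
    have hv : PowerSeries.derivative R (lineEval ξ n (X v)) = geom R ^ 2 := by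
      rcases v with i | i <;>
      simp [lineEval, derivative_geom]
    have hs : ∑ i, (pderiv (Sum.inl i) (X v : MvPolynomial (Fin n ⊕ Fin n) ℝ) +
        pderiv (Sum.inr i) (X v)) = 1 := by
      classical
      rcases v with i | i <;> simp [Pi.single_apply]
    have hsum : ∑ i, (pderiv (Sum.inl i) (p * X v) + pderiv (Sum.inr i) (p * X v)) =
        (∑ i, (pderiv (Sum.inl i) p + pderiv (Sum.inr i) p)) * X v + p * 1 := by
      rw [← hs, Finset.sum_mul, Finset.mul_sum, ← Finset.sum_add_distrib]
      refine Finset.sum_congr rfl fun i _ => ?_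
      rw [pderiv_mul, pderiv_mul]; ring
    rw [hsum, map_mul, Derivation.leibniz, hp, hv]
    simp only [map_add, map_mul, map_one, smul_eq_mul]
    ring

theorem lineEval_rename (ξ : ℕ → R) (n : ℕ) (f : MvPolynomial (Fin n ⊕ Fin n) ℝ) :
    lineEval ξ (n + 1) (rename (Sum.map Fin.castSucc Fin.castSucc) f) = lineEval ξ n f := by
  rw [lineEval, aeval_rename, lineEval]
  congr 2
  ext1 v
  rcases v with i | i <;> simp

/-- On the line, (w + ξ(1 − w))(1 − w)⁻² equals x·y for the new pair of variables. The product rule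
for (xyA)′ then yields (1 − w)⁻² times both terms of the recursion: (x + y)A from the prefactor and
xy·Σ(∂A) from A. -/
theorem lineEval_eulerianH_succ (ξ : ℕ → R) (n : ℕ) :
    geom R ^ 2 * lineEval ξ (n + 1) (eulerianH (n + 1)) =
      PowerSeries.derivative R ((PowerSeries.X + PowerSeries.C (ξ n) * (1 - PowerSeries.X)) *
        (geom R ^ 2 * lineEval ξ n (eulerianH n))) := by
  have hB : ∑ i : Fin n, (pderiv (Sum.inl i.castSucc)
        (rename (Sum.map Fin.castSucc Fin.castSucc) (eulerianH n) :
          MvPolynomial (Fin (n + 1) ⊕ Fin (n + 1)) ℝ) + pderiv (Sum.inr i.castSucc)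
        (rename (Sum.map Fin.castSucc Fin.castSucc) (eulerianH n))) =
      rename (Sum.map Fin.castSucc Fin.castSucc)
        (∑ i, (pderiv (Sum.inl i) (eulerianH n) + pderiv (Sum.inr i) (eulerianH n))) := by
    rw [map_sum]
    refine Finset.sum_congr rfl fun i _ => ?_
    have hinj : Function.Injective (Sum.map (Fin.castSucc (n := n)) (Fin.castSucc (n := n))) :=
      (Fin.castSucc_injective n).sumMap (Fin.castSucc_injective n)
    have h1 := pderiv_rename hinj (Sum.inl i) (eulerianH n)
    have h2 := pderiv_rename hinj (Sum.inr i) (eulerianH n)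
    rw [Sum.map_inl] at h1
    rw [Sum.map_inr] at h2
    rw [h1, h2, map_add]
  have hx : lineEval ξ (n + 1) (X (Sum.inl (Fin.last n))) =
      geom R - 1 + PowerSeries.C (ξ n) := by simp [lineEval]
  have hy : lineEval ξ (n + 1) (X (Sum.inr (Fin.last n))) = geom R := by simp [lineEval]
  have hd := derivative_lineEval ξ n (eulerianH n)
  have hg := geom_mul R
  have key : (PowerSeries.X + PowerSeries.C (ξ n) * (1 - PowerSeries.X)) *
      (geom R ^ 2 * lineEval ξ n (eulerianH n)) =
      (geom R - 1 + PowerSeries.C (ξ n)) * (geom R * lineEval ξ n (eulerianH n)) := by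
    linear_combination (PowerSeries.C (ξ n) - 1) * geom R * lineEval ξ n (eulerianH n) * hg
  rw [key]
  simp only [Derivation.leibniz, smul_eq_mul, map_add, map_sub, Derivation.map_one_eq_zero,
    PowerSeries.derivative_C, derivative_geom, hd]
  simp only [eulerianH, hB, map_add, map_mul, hx, hy, lineEval_rename]
  ring

theorem coeff_lineEval_eulerianH (ξ : ℕ → R) (n k : ℕ) :
    PowerSeries.coeff k (geom R ^ 2 * lineEval ξ n (eulerianH n)) = eulerSeq ξ n k := by
  induction n generalizing k with
  | zero =>
    rw [← derivative_geom]
    simp [eulerianH, eulerSeq, PowerSeries.coeff_derivative, geom]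
  | succ n ih =>
    rw [lineEval_eulerianH_succ, PowerSeries.coeff_derivative]
    have : (PowerSeries.X + PowerSeries.C (ξ n) * (1 - PowerSeries.X)) *
        (geom R ^ 2 * lineEval ξ n (eulerianH n)) =
        PowerSeries.C (1 - ξ n) * ((geom R ^ 2 * lineEval ξ n (eulerianH n)) * PowerSeries.X) +
        PowerSeries.C (ξ n) * (geom R ^ 2 * lineEval ξ n (eulerianH n)) := by
      rw [map_sub, map_one]; ring
    rw [this, map_add, PowerSeries.coeff_C_mul, PowerSeries.coeff_C_mul,
      PowerSeries.coeff_succ_mul_X, ih, ih, eulerSeq]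
    ring

/-- At w = 0 the line passes through x = ξ, y = 1, so the value sought is the constant coefficient.
-/
theorem aeval_eulerian (ξ : ℕ → R) (n : ℕ) :
    aeval (fun i : Fin n => ξ i) (eulerian n) = eulerSeq ξ n 0 := by
  rw [← coeff_lineEval_eulerianH, PowerSeries.coeff_zero_eq_constantCoeff_apply, map_mul, map_pow,
    show PowerSeries.constantCoeff (geom R) = 1 by simp [geom], one_pow, one_mul, eulerian,
    lineEval]
  have h : ∀ f : MvPolynomial (Fin n ⊕ Fin n) ℝ,
      aeval (fun i : Fin n => ξ i)
        (aeval (Sum.elim X (fun _ => 1)) f : MvPolynomial (Fin n) ℝ) =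
      PowerSeries.constantCoeff (aeval (Sum.elim (fun i : Fin n => geom R - 1 + PowerSeries.C (ξ i))
        (fun _ => geom R)) f) := by
    intro f
    induction f using MvPolynomial.induction_on with
    | C a => simp [PowerSeries.algebraMap_apply]
    | add p q hp hq => simp only [map_add, hp, hq]
    | mul_X p v hp =>
      rcases v with i | i <;> simp only [map_mul, hp, aeval_X] <;> simp [geom]
  exact h _

end Line

theorem rename_eulerian (n : ℕ) :
    rename (Fin.val : Fin n → ℕ) (eulerian n) = eulerSeq X n 0 := by
  have h : (rename Fin.val : MvPolynomial (Fin n) ℝ →ₐ[ℝ] MvPolynomial ℕ ℝ) =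
      aeval (fun i : Fin n => X (i : ℕ)) := by
    ext i; simp
  rw [← aeval_eulerian, h]

/-! ### Jets of the Eulerian polynomials at the origin -/

theorem constantCoeff_eulerSeq (n k : ℕ) :
    constantCoeff (eulerSeq (X : ℕ → MvPolynomial ℕ ℝ) n k) = (k + 1 : ℝ) ^ (n + 1) := by
  induction n generalizing k with
  | zero => simp [eulerSeq]
  | succ n ih => simp [eulerSeq, ih]; ring

theorem pderiv_eulerSeq_succ_of_ne (n k : ℕ) {i : ℕ} (h : i ≠ n) :
    pderiv i (eulerSeq (X : ℕ → MvPolynomial ℕ ℝ) (n + 1) k) =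
      ((k : MvPolynomial ℕ ℝ) + 1) *
        ((1 - X n) * pderiv i (eulerSeq X n k) + X n * pderiv i (eulerSeq X n (k + 1))) := by
  simp [eulerSeq, pderiv_X_of_ne h.symm]

theorem pderiv_eulerSeq_of_le (n k : ℕ) {i : ℕ} (h : n ≤ i) :
    pderiv i (eulerSeq (X : ℕ → MvPolynomial ℕ ℝ) n k) = 0 := by
  induction n generalizing k with
  | zero => simp [eulerSeq]
  | succ n ih =>
    rw [pderiv_eulerSeq_succ_of_ne _ _ (by omega), ih _ (by omega), ih _ (by omega)]
    simp

theorem pderiv_eulerSeq_succ_self (n k : ℕ) :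
    pderiv n (eulerSeq (X : ℕ → MvPolynomial ℕ ℝ) (n + 1) k) =
      ((k : MvPolynomial ℕ ℝ) + 1) * (eulerSeq X n (k + 1) - eulerSeq X n k) := by
  simp only [eulerSeq, pderiv_mul, map_add, map_sub, Derivation.map_natCast, pderiv_one,
    pderiv_eulerSeq_of_le _ _ le_rfl, pderiv_X_self]
  ring

/-- At ξ = 0 each step multiplies level k by k + 1. Differentiating in a variable at the step that
introduces it produces the difference of levels k + 1 and k instead. Here r counts the later steps;
higher jets iterate the same difference. -/
theorem jet₁_eulerSeq (i r k : ℕ) :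
    jet₁ (eulerSeq X (i + 1 + r) k) i =
      (k + 1 : ℝ) ^ (r + 1) * ((k + 2) ^ (i + 1) - (k + 1) ^ (i + 1)) := by
  induction r generalizing k with
  | zero =>
    rw [add_zero, jet₁, pderiv_eulerSeq_succ_self]
    simp [constantCoeff_eulerSeq]; left; ring
  | succ r ih =>
    have h := ih k
    rw [jet₁] at h
    rw [← add_assoc, jet₁, pderiv_eulerSeq_succ_of_ne _ _ (by omega)]
    simp [h]; ring

theorem jet₂_eulerSeq (i t r k : ℕ) :
    jet₂ (eulerSeq X (i + 1 + t + 1 + r) k) i (i + 1 + t) =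
      (k + 1 : ℝ) ^ (r + 1) * ((k + 2) ^ (t + 1) * ((k + 3) ^ (i + 1) - (k + 2) ^ (i + 1)) -
        (k + 1) ^ (t + 1) * ((k + 2) ^ (i + 1) - (k + 1) ^ (i + 1))) := by
  induction r generalizing k with
  | zero =>
    rw [add_zero, jet₂, pderiv_eulerSeq_succ_self]
    have h1 := jet₁_eulerSeq i t (k + 1)
    have h2 := jet₁_eulerSeq i t k
    rw [jet₁] at h1 h2
    simp [h1, h2]; left; ring
  | succ r ih =>
    rw [← add_assoc, jet₂, pderiv_eulerSeq_succ_of_ne _ _ (by omega)]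
    have hX : pderiv i (X (i + 1 + t + 1 + r) : MvPolynomial ℕ ℝ) = 0 :=
      pderiv_X_of_ne (by omega)
    have h1 := ih k
    rw [jet₂] at h1
    simp [hX, h1]; ring

theorem jet₃_eulerSeq (i t u r k : ℕ) :
    jet₃ (eulerSeq X (i + 1 + t + 1 + u + 1 + r) k) i (i + 1 + t) (i + 1 + t + 1 + u) =
      (k + 1 : ℝ) ^ (r + 1) *
       ((k + 2 : ℝ) ^ (u + 1) * ((k + 3) ^ (t + 1) * ((k + 4) ^ (i + 1) - (k + 3) ^ (i + 1)) -
        (k + 2) ^ (t + 1) * ((k + 3) ^ (i + 1) - (k + 2) ^ (i + 1))) -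
       (k + 1 : ℝ) ^ (u + 1) * ((k + 2) ^ (t + 1) * ((k + 3) ^ (i + 1) - (k + 2) ^ (i + 1)) -
        (k + 1) ^ (t + 1) * ((k + 2) ^ (i + 1) - (k + 1) ^ (i + 1)))) := by
  induction r generalizing k with
  | zero =>
    rw [add_zero, jet₃, pderiv_eulerSeq_succ_self]
    have h1 := jet₂_eulerSeq i t u (k + 1)
    have h2 := jet₂_eulerSeq i t u k
    rw [jet₂] at h1 h2
    simp [h1, h2]; left; ring
  | succ r ih =>
    rw [← add_assoc, jet₃, pderiv_eulerSeq_succ_of_ne _ _ (by omega)]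
    have hX : pderiv i (X (i + 1 + t + 1 + u + 1 + r) : MvPolynomial ℕ ℝ) = 0 :=
      pderiv_X_of_ne (by omega)
    have hX' : pderiv (i + 1 + t) (X (i + 1 + t + 1 + u + 1 + r) : MvPolynomial ℕ ℝ) = 0 :=
      pderiv_X_of_ne (by omega)
    have h1 := ih k
    rw [jet₃] at h1
    simp [hX, hX', h1]; ring

/-- Each variable enters in one step only, and affinely. -/
theorem pderiv_pderiv_eulerSeq (i n k : ℕ) :
    pderiv i (pderiv i (eulerSeq (X : ℕ → MvPolynomial ℕ ℝ) n k)) = 0 := by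
  induction n generalizing k with
  | zero => simp [eulerSeq]
  | succ n ih =>
    by_cases h : i = n
    · subst h
      rw [pderiv_eulerSeq_succ_self]
      simp [pderiv_eulerSeq_of_le]
    · rw [pderiv_eulerSeq_succ_of_ne _ _ h]
      have hX : pderiv i (X n : MvPolynomial ℕ ℝ) = 0 := pderiv_X_of_ne (Ne.symm h)
      simp [hX, ih]

/-- The dominant factor of `quad` and `cubic` contributed by the smallest index `i`. -/
def alpha (i : ℕ) : ℝ := 2 ^ (i + 1) - (3 / 2) ^ (i + 1)

/-- The subdominant factor of `cubic` contributed by the smallest index `i`. -/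
def beta (i : ℕ) : ℝ := 2 ^ (i + 1) - (4 / 3) ^ (i + 1)

section Values

variable {n i j k : ℕ}

theorem jet₁_eulerian (hi : i < n) : jet₁ (eulerSeq X n 0) i = 2 ^ (i + 1) - 1 := by
  obtain ⟨r, rfl⟩ := Nat.exists_eq_add_of_lt hi
  rw [show i + r + 1 = i + 1 + r by ring, jet₁_eulerSeq]
  norm_num

theorem jet₂_eulerian (hij : i < j) (hj : j < n) :
    jet₂ (eulerSeq X n 0) i j =
      2 ^ (j + 1) * (3 / 2) ^ (i + 1) - 2 ^ (j + 1) - 2 ^ (i + 1) + 1 := by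
  obtain ⟨t, rfl⟩ := Nat.exists_eq_add_of_lt hij
  obtain ⟨r, rfl⟩ := Nat.exists_eq_add_of_lt hj
  rw [show i + t + 1 = i + 1 + t by ring, show i + 1 + t + r + 1 = i + 1 + t + 1 + r by ring,
    jet₂_eulerSeq, div_pow]
  norm_num
  field_simp
  ring

theorem jet₃_eulerian (hij : i < j) (hjk : j < k) (hk : k < n) :
    jet₃ (eulerSeq X n 0) i j k =
      2 ^ (k + 1) * (3 / 2) ^ (j + 1) * (4 / 3) ^ (i + 1) - 2 ^ (k + 1) * (3 / 2) ^ (j + 1)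
        - 2 ^ (k + 1) * (3 / 2) ^ (i + 1) - 2 ^ (j + 1) * (3 / 2) ^ (i + 1) +
        2 ^ (i + 1) + 2 ^ (j + 1) + 2 ^ (k + 1) - 1 := by
  obtain ⟨t, rfl⟩ := Nat.exists_eq_add_of_lt hij
  obtain ⟨u, rfl⟩ := Nat.exists_eq_add_of_lt hjk
  obtain ⟨r, rfl⟩ := Nat.exists_eq_add_of_lt hk
  rw [show i + t + 1 + u + 1 = i + 1 + t + 1 + u by ring, show i + t + 1 = i + 1 + t by ring,
    show i + 1 + t + 1 + u + r + 1 = i + 1 + t + 1 + u + 1 + r by ring,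
    jet₃_eulerSeq, div_pow, div_pow, div_pow]
  norm_num
  field_simp
  ring

theorem jet₂_eulerian_self : jet₂ (eulerSeq X n 0) i i = 0 := by
  rw [jet₂, pderiv_pderiv_eulerSeq, map_zero]

theorem jet₃_eulerian_self : jet₃ (eulerSeq X n 0) i i j = 0 := by
  rw [jet₃_swap_right, jet₃_swap_left, jet₃, pderiv_pderiv_eulerSeq, map_zero, map_zero]

theorem quad_eulerian_self (hi : i < n) :
    quad (eulerSeq X n 0) i i = (2 ^ (i + 1) - 1) ^ 2 := by
  rw [quad, jet₂_eulerian_self, jet₁_eulerian hi]; ring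

/-- The product of first derivatives cancels every term of the mixed derivative but one. The value
thus splits into 2^(j+1) for the larger index and a factor for the smaller one, which makes row sums
nearly geometric. -/
theorem quad_eulerian (hij : i < j) (hj : j < n) :
    quad (eulerSeq X n 0) i j = 2 ^ (j + 1) * alpha i := by
  rw [quad, jet₂_eulerian hij hj, jet₁_eulerian hj, jet₁_eulerian (hij.trans hj), alpha]; ring

theorem cubic_eulerian_self (hi : i < n) :
    cubic (eulerSeq X n 0) i i i = (2 ^ (i + 1) - 1) ^ 3 := by
  rw [cubic, jet₂_eulerian_self, jet₃_eulerian_self, jet₁_eulerian hi]; ring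

theorem cubic_eulerian_self_left (hij : i < j) (hj : j < n) :
    cubic (eulerSeq X n 0) i i j = (2 ^ (i + 1) - 1) * (2 ^ (j + 1) * alpha i) := by
  rw [cubic, jet₂_eulerian_self, jet₃_eulerian_self, jet₂_eulerian hij hj, jet₁_eulerian hj,
    jet₁_eulerian (hij.trans hj), alpha]; ring

theorem cubic_eulerian_self_right (hij : i < j) (hj : j < n) :
    cubic (eulerSeq X n 0) i j j = (2 ^ (j + 1) - 1) * (2 ^ (j + 1) * alpha i) := by
  rw [cubic, jet₂_eulerian_self, jet₃_swap_left, jet₃_swap_right, jet₃_eulerian_self,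
    jet₂_eulerian hij hj, jet₁_eulerian hj, jet₁_eulerian (hij.trans hj), alpha]; ring

theorem cubic_eulerian (hij : i < j) (hjk : j < k) (hk : k < n) :
    cubic (eulerSeq X n 0) i j k = 2 ^ (j + 1) * 2 ^ (k + 1) * alpha i -
      (3 / 2) ^ (j + 1) * 2 ^ (k + 1) * beta i / 2 := by
  rw [cubic, jet₃_eulerian hij hjk hk, jet₂_eulerian hij (hjk.trans hk),
    jet₂_eulerian (hij.trans hjk) hk, jet₂_eulerian hjk hk, jet₁_eulerian hk,
    jet₁_eulerian (hjk.trans hk), jet₁_eulerian (hij.trans (hjk.trans hk)), alpha, beta]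
  ring

theorem alpha_nonneg (i : ℕ) : 0 ≤ alpha i :=
  sub_nonneg.2 (pow_le_pow_left₀ (by norm_num) (by norm_num) _)

theorem alpha_le (i : ℕ) : alpha i ≤ 2 ^ (i + 1) := sub_le_self _ (by positivity)

theorem beta_nonneg (i : ℕ) : 0 ≤ beta i :=
  sub_nonneg.2 (pow_le_pow_left₀ (by norm_num) (by norm_num) _)

theorem beta_le (i : ℕ) : beta i ≤ 2 ^ (i + 1) := sub_le_self _ (by positivity)

theorem abs_quad_eulerian_le (hi : i < n) (hj : j < n) :
    |quad (eulerSeq X n 0) i j| ≤ 2 ^ (i + 1) * 2 ^ (j + 1) := by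
  wlog hij : i ≤ j generalizing i j
  · rw [quad_comm, mul_comm]; exact this hj hi (by omega)
  have h1 : (1 : ℝ) ≤ 2 ^ (i + 1) := one_le_pow₀ (by norm_num)
  rcases hij.eq_or_lt with rfl | hij
  · rw [quad_eulerian_self hi, abs_of_nonneg (by positivity)]
    nlinarith
  · have := alpha_nonneg i
    rw [quad_eulerian hij hj, abs_of_nonneg (by positivity), mul_comm]
    gcongr
    exact alpha_le i

theorem abs_sub_half_le {a b c : ℝ} (ha : 0 ≤ a) (hac : a ≤ c) (hb : 0 ≤ b) (hbc : b ≤ c) :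
    |a - b / 2| ≤ c := abs_le.2 ⟨by linarith, by linarith⟩

/-- A crude bound with one factor 2^(index + 1) per variable; this product shape lets every
perturbation term be bounded through `weight`. -/
theorem abs_cubic_eulerian_le (hi : i < n) (hj : j < n) (hk : k < n) :
    |cubic (eulerSeq X n 0) i j k| ≤ 2 ^ (i + 1) * 2 ^ (j + 1) * 2 ^ (k + 1) := by
  wlog hij : i ≤ j generalizing i j k
  · rw [cubic_swap_left, mul_comm (2 ^ (i + 1))]; exact this hj hi hk (by omega)
  wlog hjk : j ≤ k generalizing i j k
  · rw [cubic_swap_right, mul_right_comm]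
    rcases le_total i k with h | h
    · exact this hi hk hj h (by omega)
    · rw [cubic_swap_left, mul_comm (2 ^ (i + 1))]
      exact this hk hi hj h hij
  have hi1 : (1 : ℝ) ≤ 2 ^ (i + 1) := one_le_pow₀ (by norm_num)
  have hk1 : (1 : ℝ) ≤ 2 ^ (k + 1) := one_le_pow₀ (by norm_num)
  have ha := alpha_nonneg i
  have ha' := alpha_le i
  have hb := beta_nonneg i
  have hb' := beta_le i
  rcases hij.eq_or_lt with rfl | hij
  · rcases hjk.eq_or_lt with rfl | hjk
    · rw [cubic_eulerian_self hi, abs_of_nonneg (pow_nonneg (by linarith) _), ← pow_two,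
        ← pow_succ]
      exact pow_le_pow_left₀ (by linarith) (by linarith) _
    · rw [cubic_eulerian_self_left hjk hk, abs_of_nonneg
        (mul_nonneg (by linarith) (by positivity)), mul_comm _ (alpha i), ← mul_assoc]
      gcongr
      linarith
  · rcases hjk.eq_or_lt with rfl | hjk
    · rw [cubic_eulerian_self_right hij hj, abs_of_nonneg
        (mul_nonneg (by linarith) (by positivity)), mul_comm _ (alpha i), mul_comm, mul_assoc,
        mul_assoc]
      gcongr
      linarith
    · rw [cubic_eulerian hij hjk hk]
      have h32 : (3 / 2 : ℝ) ^ (j + 1) ≤ 2 ^ (j + 1) :=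
        pow_le_pow_left₀ (by norm_num) (by norm_num) _
      apply abs_sub_half_le (by positivity) _ (by positivity)
      · calc (3 / 2 : ℝ) ^ (j + 1) * 2 ^ (k + 1) * beta i
            ≤ 2 ^ (j + 1) * 2 ^ (k + 1) * 2 ^ (i + 1) := by gcongr
          _ = _ := by ring
      · calc (2 : ℝ) ^ (j + 1) * 2 ^ (k + 1) * alpha i
            ≤ 2 ^ (j + 1) * 2 ^ (k + 1) * 2 ^ (i + 1) := by gcongr
          _ = _ := by ring

end Values

/-! ### Transfer to finitely many variables and degree -/

section Transfer

variable {n : ℕ}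

theorem constantCoeff_eulerian (n : ℕ) : constantCoeff (eulerian n) = 1 := by
  rw [← constantCoeff_rename (Fin.val : Fin n → ℕ), rename_eulerian, constantCoeff_eulerSeq]
  norm_num

theorem jet₁_eulerian_eq (i : Fin n) : jet₁ (eulerian n) i = jet₁ (eulerSeq X n 0) (i : ℕ) := by
  rw [jet₁, jet₁, ← rename_eulerian, pderiv_rename Fin.val_injective, constantCoeff_rename]

theorem jet₂_eulerian_eq (i j : Fin n) :
    jet₂ (eulerian n) i j = jet₂ (eulerSeq X n 0) (i : ℕ) (j : ℕ) := by
  rw [jet₂, jet₂, ← rename_eulerian, pderiv_rename Fin.val_injective,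
    pderiv_rename Fin.val_injective, constantCoeff_rename]

theorem jet₃_eulerian_eq (i j k : Fin n) :
    jet₃ (eulerian n) i j k = jet₃ (eulerSeq X n 0) (i : ℕ) (j : ℕ) (k : ℕ) := by
  rw [jet₃, jet₃, ← rename_eulerian, pderiv_rename Fin.val_injective,
    pderiv_rename Fin.val_injective, pderiv_rename Fin.val_injective, constantCoeff_rename]

theorem quad_eulerian_eq (i j : Fin n) :
    quad (eulerian n) i j = quad (eulerSeq X n 0) (i : ℕ) (j : ℕ) := by
  simp only [quad, jet₁_eulerian_eq, jet₂_eulerian_eq]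

theorem cubic_eulerian_eq (i j k : Fin n) :
    cubic (eulerian n) i j k = cubic (eulerSeq X n 0) (i : ℕ) (j : ℕ) (k : ℕ) := by
  simp only [cubic, jet₁_eulerian_eq, jet₂_eulerian_eq, jet₃_eulerian_eq]

end Transfer

theorem isHomogeneous_eulerianH (n : ℕ) : (eulerianH n).IsHomogeneous n := by
  induction n with
  | zero => exact isHomogeneous_one _ _
  | succ n ih =>
    have hB := ih.rename_isHomogeneous (f := Sum.map (Fin.castSucc (n := n)) (Fin.castSucc (n := n)))
    simp only [eulerianH]
    refine IsHomogeneous.add ?_ ?_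
    · convert! ((isHomogeneous_X _ _).add (isHomogeneous_X _ _)).mul hB using 1
      ring
    · rcases Nat.eq_zero_or_pos n with rfl | hn
      · simpa using isHomogeneous_zero _ _ _
      · have h2 : n + 1 = 1 + 1 + (n - 1) := by omega
        convert! ((isHomogeneous_X _ _).mul (isHomogeneous_X _ _)).mul
          (IsHomogeneous.sum _ _ _ fun i _ => hB.pderiv.add hB.pderiv) using 1

end EulerianRelaxation
end

/-! ### Univariate Eulerian polynomials as diagonal restrictions, and their 2×2 pencil. -/

open scoped Matrix
noncomputable section
namespace EulerianRelaxation
open MvPolynomial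

/-! ### The univariate Eulerian polynomials -/

/-- Restriction to `x = (X, …, X)`, `y = (1, …, 1)`. -/
def diagH (n : ℕ) : MvPolynomial (Fin n ⊕ Fin n) ℝ →ₐ[ℝ] Polynomial ℝ :=
  aeval (Sum.elim (fun _ => Polynomial.X) (fun _ => 1))

/-- Restriction to the diagonal `x = (X, …, X)`. -/
def diag (n : ℕ) : MvPolynomial (Fin n) ℝ →ₐ[ℝ] Polynomial ℝ := aeval (fun _ => Polynomial.X)

theorem diag_eulerian (n : ℕ) : diag n (eulerian n) = diagH n (eulerianH n) := by
  have h : (diag n).comp (aeval (Sum.elim X (fun _ => 1))) = diagH n := by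
    ext v
    rcases v with i | i <;> simp [diag, diagH]
  rw [← h]; rfl

theorem derivative_diagH (n : ℕ) (f : MvPolynomial (Fin n ⊕ Fin n) ℝ) :
    Polynomial.derivative (diagH n f) = diagH n (∑ i, pderiv (Sum.inl i) f) := by
  classical
  induction f using MvPolynomial.induction_on with
  | C a => simp [diagH, Polynomial.algebraMap_eq]
  | add p q hp hq => simp only [map_add, hp, hq, Finset.sum_add_distrib]
  | mul_X p v hp =>
    have hs : ∑ i, pderiv (Sum.inl i) (p * X v) =
        (∑ i, pderiv (Sum.inl i) p) * X v + p * ∑ i, pderiv (Sum.inl i) (X v) := by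
      rw [Finset.sum_mul, Finset.mul_sum, ← Finset.sum_add_distrib]
      exact Finset.sum_congr rfl fun i _ => pderiv_mul
    rw [hs, map_mul, Polynomial.derivative_mul, hp, map_add, map_mul, map_mul]
    rcases v with i | i <;> simp [diagH, Pi.single_apply]

theorem derivative_diag (n : ℕ) (f : MvPolynomial (Fin n) ℝ) :
    Polynomial.derivative (diag n f) = diag n (∑ i, pderiv i f) := by
  classical
  induction f using MvPolynomial.induction_on with
  | C a => simp [diag, Polynomial.algebraMap_eq]
  | add p q hp hq => simp only [map_add, hp, hq, Finset.sum_add_distrib]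
  | mul_X p v hp =>
    have hs : ∑ i, pderiv i (p * X v) = (∑ i, pderiv i p) * X v + p * ∑ i, pderiv i (X v) := by
      rw [Finset.sum_mul, Finset.mul_sum, ← Finset.sum_add_distrib]
      exact Finset.sum_congr rfl fun i _ => pderiv_mul
    rw [hs, map_mul, Polynomial.derivative_mul, hp, map_add, map_mul, map_mul]
    simp [diag, Pi.single_apply]

theorem coeff_zero_diag (n : ℕ) (f : MvPolynomial (Fin n) ℝ) :
    (diag n f).coeff 0 = constantCoeff f := by
  induction f using MvPolynomial.induction_on with
  | C a => simp [diag, Polynomial.algebraMap_eq]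
  | add p q hp hq => simp only [map_add, Polynomial.coeff_add, hp, hq]
  | mul_X p v hp => simp [diag]

theorem diagH_eulerianH (n : ℕ) : diagH n (eulerianH n) = eulerianUni n := by
  induction n with
  | zero => simp [eulerianH, eulerianUni]
  | succ n ih =>
    have hren : ∀ f, diagH (n + 1) (rename (Sum.map Fin.castSucc Fin.castSucc) f) = diagH n f := by
      intro f
      rw [diagH, aeval_rename, diagH]
      congr 2
      ext1 v
      rcases v with i | i <;> simp
    have hinj : Function.Injective (Sum.map (Fin.castSucc (n := n)) (Fin.castSucc (n := n))) :=
      (Fin.castSucc_injective n).sumMap (Fin.castSucc_injective n)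
    have h1 : ∀ i : Fin n, diagH (n + 1) (pderiv (Sum.inl i.castSucc)
        (rename (Sum.map Fin.castSucc Fin.castSucc) (eulerianH n))) =
        diagH n (pderiv (Sum.inl i) (eulerianH n)) := fun i => by
      rw [← hren, ← pderiv_rename hinj, Sum.map_inl]
    have h2 : ∀ i : Fin n, diagH (n + 1) (pderiv (Sum.inr i.castSucc)
        (rename (Sum.map Fin.castSucc Fin.castSucc) (eulerianH n))) =
        diagH n (pderiv (Sum.inr i) (eulerianH n)) := fun i => by
      rw [← hren, ← pderiv_rename hinj, Sum.map_inr]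
    -- Euler's relation for a homogeneous polynomial: at y = 1 it trades the y-derivatives in the
    -- recursion for n·A minus X times the x-derivatives.
    have hE := congrArg (diagH n) (isHomogeneous_eulerianH n).sum_X_mul_pderiv
    have hd := derivative_diagH n (eulerianH n)
    have hX : diagH (n + 1) (X (Sum.inl (Fin.last n))) = Polynomial.X := by simp [diagH]
    have hY : diagH (n + 1) (X (Sum.inr (Fin.last n))) = 1 := by simp [diagH]
    have hX' : ∀ i, diagH n (X (Sum.inl i)) = Polynomial.X := fun i => by simp [diagH]
    have hY' : ∀ i, diagH n (X (Sum.inr i)) = 1 := fun i => by simp [diagH]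
    simp only [map_sum, map_mul, Fintype.sum_sum_type, map_natCast, hX', hY', map_add, one_mul,
      ← Finset.mul_sum, ih, nsmul_eq_mul] at hE hd
    simp only [eulerianH, eulerianUni, map_add, map_mul, map_sum, h1, h2, hren, ih, hX, hY,
      Finset.sum_add_distrib, Polynomial.derivative_mul, Polynomial.derivative_X]
    rw [hd]
    linear_combination Polynomial.X * hE

theorem coeff_zero_eulerianUni (n : ℕ) : (eulerianUni n).coeff 0 = 1 := by
  rw [← diagH_eulerianH, ← diag_eulerian, coeff_zero_diag, constantCoeff_eulerian]

theorem coeff_succ_eulerianUni (n k : ℕ) :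
    (eulerianUni (n + 1)).coeff (k + 1) =
      (k + 2) * (eulerianUni n).coeff (k + 1) + (n + 1 - k) * (eulerianUni n).coeff k := by
  have : eulerianUni (n + 1) = ((n : Polynomial ℝ) + 1) * (eulerianUni n * Polynomial.X) +
      eulerianUni n + Polynomial.derivative (eulerianUni n) * Polynomial.X -
        Polynomial.derivative (eulerianUni n) * Polynomial.X * Polynomial.X := by
    rw [eulerianUni, Polynomial.derivative_mul, Polynomial.derivative_X]; ring
  have hC : ((n : Polynomial ℝ) + 1) = Polynomial.C ((n : ℝ) + 1) := by simp
  rw [this, hC]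
  simp only [Polynomial.coeff_add, Polynomial.coeff_sub, Polynomial.coeff_C_mul,
    Polynomial.coeff_mul_X, Polynomial.coeff_derivative]
  rcases k with _ | k
  · simp; ring
  · rw [Polynomial.coeff_mul_X, Polynomial.coeff_derivative]
    push_cast; ring

theorem coeff_eulerianUni_of_lt {n k : ℕ} (h : n < k) : (eulerianUni n).coeff k = 0 := by
  induction n generalizing k with
  | zero => rw [eulerianUni, Polynomial.coeff_one, if_neg (by omega)]
  | succ n ih =>
    obtain ⟨k, rfl⟩ : ∃ l, k = l + 1 := ⟨k - 1, by omega⟩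
    rw [coeff_succ_eulerianUni, ih (by omega), ih (by omega)]; ring

theorem coeff_self_eulerianUni (n : ℕ) : (eulerianUni n).coeff n = 1 := by
  induction n with
  | zero => simp [eulerianUni]
  | succ n ih => rw [coeff_succ_eulerianUni, ih, coeff_eulerianUni_of_lt (by omega)]; ring

theorem natDegree_eulerianUni (n : ℕ) : (eulerianUni n).natDegree = n :=
  le_antisymm (Polynomial.natDegree_le_iff_coeff_eq_zero.2 fun _ h => coeff_eulerianUni_of_lt h)
    (Polynomial.le_natDegree_of_ne_zero (by rw [coeff_self_eulerianUni]; norm_num))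

/-- The linear coefficient of the Eulerian polynomial. -/
def e₁ (n : ℕ) : ℝ := 2 ^ (n + 1) - (n + 2)

/-- The quadratic coefficient of the Eulerian polynomial. -/
def e₂ (n : ℕ) : ℝ := 3 ^ (n + 1) - (n + 2) * 2 ^ (n + 1) + (n + 1) * (n + 2) / 2

/-- The cubic coefficient of the Eulerian polynomial. -/
def e₃ (n : ℕ) : ℝ := 4 ^ (n + 1) - (n + 2) * 3 ^ (n + 1) + (n + 1) * (n + 2) / 2 * 2 ^ (n + 1) -
  n * (n + 1) * (n + 2) / 6

theorem coeff_one_eulerianUni (n : ℕ) : (eulerianUni n).coeff 1 = e₁ n := by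
  induction n with
  | zero => rw [coeff_eulerianUni_of_lt (by omega)]; norm_num [e₁]
  | succ n ih =>
    rw [coeff_succ_eulerianUni, zero_add, ih, coeff_zero_eulerianUni, e₁, e₁]
    push_cast; ring

theorem coeff_two_eulerianUni (n : ℕ) : (eulerianUni n).coeff 2 = e₂ n := by
  induction n with
  | zero => rw [coeff_eulerianUni_of_lt (by omega)]; norm_num [e₂]
  | succ n ih =>
    rw [coeff_succ_eulerianUni, ih, coeff_one_eulerianUni, e₁, e₂, e₂]
    push_cast; ring

theorem coeff_three_eulerianUni (n : ℕ) : (eulerianUni n).coeff 3 = e₃ n := by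
  induction n with
  | zero => rw [coeff_eulerianUni_of_lt (by omega)]; norm_num [e₃]
  | succ n ih =>
    rw [coeff_succ_eulerianUni, ih, coeff_two_eulerianUni, e₂, e₃, e₃]
    push_cast; ring

/-- The value `L(x²)` for the univariate Eulerian polynomial. -/
def ell₂ (n : ℕ) : ℝ := e₁ n ^ 2 - 2 * e₂ n

/-- The value `L(x³)` for the univariate Eulerian polynomial. -/
def ell₃ (n : ℕ) : ℝ := e₁ n ^ 3 - 3 * e₁ n * e₂ n + 3 * e₃ n

theorem diag_eulerian_eq (n : ℕ) : diag n (eulerian n) = eulerianUni n := by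
  rw [diag_eulerian, diagH_eulerianH]

theorem sum_jet₁_eulerian (n : ℕ) : ∑ i, jet₁ (eulerian n) i = e₁ n := by
  have h := congrArg (Polynomial.coeff · 0) (derivative_diag n (eulerian n))
  rw [diag_eulerian_eq] at h
  simp only [coeff_zero_diag, map_sum, Polynomial.coeff_derivative, zero_add,
    coeff_one_eulerianUni, Polynomial.finsetSum_coeff] at h
  simp only [jet₁, ← h]
  simp

theorem sum_jet₂_eulerian (n : ℕ) : ∑ i, ∑ j, jet₂ (eulerian n) i j = 2 * e₂ n := by
  have h := congrArg (fun p => Polynomial.coeff (Polynomial.derivative p) 0)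
    (derivative_diag n (eulerian n))
  rw [diag_eulerian_eq] at h
  simp only [derivative_diag, coeff_zero_diag, map_sum, Polynomial.coeff_derivative, zero_add,
    one_add_one_eq_two, coeff_two_eulerianUni, Polynomial.finsetSum_coeff] at h
  rw [Finset.sum_comm]
  simp only [jet₂, ← h]
  norm_num; ring

theorem sum_jet₃_eulerian (n : ℕ) : ∑ i, ∑ j, ∑ k, jet₃ (eulerian n) i j k = 6 * e₃ n := by
  have h := congrArg (fun p => Polynomial.coeff (Polynomial.derivative (Polynomial.derivative p)) 0)
    (derivative_diag n (eulerian n))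
  rw [diag_eulerian_eq] at h
  simp only [derivative_diag, coeff_zero_diag, map_sum, Polynomial.coeff_derivative, zero_add,
    one_add_one_eq_two, two_add_one_eq_three, coeff_three_eulerianUni,
    Polynomial.finsetSum_coeff] at h
  have hr : ∀ i j k, jet₃ (eulerian n) i j k = jet₃ (eulerian n) k j i := fun i j k => by
    rw [jet₃_swap_left, jet₃_swap_right, jet₃_swap_left]
  rw [Finset.sum_congr rfl fun i _ => Finset.sum_congr rfl fun j _ =>
    Finset.sum_congr rfl fun k _ => hr i j k]
  simp only [jet₃, ← h]
  norm_num; ring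

/-- With its cubic counterpart below, this says that the multivariate pencil, compressed to vectors
(a, b, …, b) on the diagonal, is the univariate pencil. -/
theorem sum_quad_eulerian (n : ℕ) : ∑ i, ∑ j, quad (eulerian n) i j = ell₂ n := by
  simp only [quad, Finset.sum_sub_distrib, sum_jet₂_eulerian, ← Finset.mul_sum, ← Finset.sum_mul,
    sum_jet₁_eulerian, ell₂]
  ring

theorem sum_cubic_eulerian (n : ℕ) :
    ∑ i, ∑ j, ∑ k, cubic (eulerian n) i j k = ell₃ n := by
  have h1 : ∑ i, ∑ j, ∑ k, jet₁ (eulerian n) i * jet₂ (eulerian n) j k = e₁ n * (2 * e₂ n) := by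
    simp only [← Finset.mul_sum, sum_jet₂_eulerian, ← Finset.sum_mul, sum_jet₁_eulerian]
  have h2 : ∑ i, ∑ j, ∑ k, jet₁ (eulerian n) j * jet₂ (eulerian n) i k = e₁ n * (2 * e₂ n) := by
    rw [Finset.sum_comm]; exact h1
  have h3 : ∑ i, ∑ j, ∑ k, jet₁ (eulerian n) k * jet₂ (eulerian n) i j = e₁ n * (2 * e₂ n) := by
    simp only [← Finset.mul_sum, sum_jet₂_eulerian, ← Finset.sum_mul, sum_jet₁_eulerian]
  have h4 : ∑ i, ∑ j, ∑ k, jet₁ (eulerian n) i * jet₁ (eulerian n) j * jet₁ (eulerian n) k =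
      e₁ n ^ 3 := by
    simp only [← Finset.mul_sum, ← Finset.sum_mul, sum_jet₁_eulerian]; ring
  simp only [cubic, Finset.sum_add_distrib, Finset.sum_sub_distrib, ← Finset.sum_div,
    sum_jet₃_eulerian, h1, h2, h3, h4, ell₃]
  ring

theorem totalDegree_eulerSeq_le {σ : Type*} (ξ : ℕ → MvPolynomial σ ℝ)
    (hξ : ∀ i, (ξ i).totalDegree ≤ 1) (n k : ℕ) : (eulerSeq ξ n k).totalDegree ≤ n := by
  have hk : ∀ k : ℕ, ((k : MvPolynomial σ ℝ) + 1).totalDegree = 0 := fun k => by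
    rw [show (k : MvPolynomial σ ℝ) + 1 = C ((k : ℝ) + 1) by simp, totalDegree_C]
  induction n generalizing k with
  | zero => exact (hk k).le
  | succ n ih =>
    rw [eulerSeq]
    refine (totalDegree_mul _ _).trans ?_
    rw [hk, zero_add]
    refine (totalDegree_add _ _).trans (max_le ?_ ?_)
    · refine (totalDegree_mul _ _).trans ?_
      have : (1 - ξ n).totalDegree ≤ 1 :=
        (totalDegree_sub _ _).trans (max_le (by simp) (hξ n))
      have := ih k
      omega
    · refine (totalDegree_mul _ _).trans ?_
      have := hξ n
      have := ih (k + 1)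
      omega

/-- The recursion raises the degree by at most one per step; conversely the diagonal restriction
already has degree n. -/
theorem totalDegree_eulerian (n : ℕ) : (eulerian n).totalDegree = n := by
  apply le_antisymm
  · have h := aeval_eulerian (R := MvPolynomial (Fin n) ℝ)
      (fun i => if h : i < n then X ⟨i, h⟩ else 0) n
    simp only [Fin.is_lt, dite_true, Fin.eta] at h
    rw [show (fun i : Fin n => (X i : MvPolynomial (Fin n) ℝ)) = X from rfl, aeval_X_left_apply] at h
    rw [h]
    refine totalDegree_eulerSeq_le _ (fun i => ?_) _ _
    split_ifs <;> simp
  · have h := MvPolynomial.aeval_natDegree_le (eulerian n) le_rfl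
      (fun _ : Fin n => (Polynomial.X : Polynomial ℝ)) (n := 1) (fun _ => by simp)
    have h2 := diag_eulerian_eq n
    rw [diag] at h2
    rw [h2, natDegree_eulerianUni, mul_one] at h
    exact h

/-! ### The univariate pencil -/

/-- The univariate Eulerian polynomial as a polynomial in one of one variables. -/
def uniPoly (n : ℕ) : MvPolynomial (Fin 1) ℝ :=
  Polynomial.aeval (X (0 : Fin 1)) (eulerianUni n)

theorem pderiv_aeval_X (f : Polynomial ℝ) :
    pderiv 0 (Polynomial.aeval (X (0 : Fin 1)) f : MvPolynomial (Fin 1) ℝ) =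
      Polynomial.aeval (X (0 : Fin 1)) (Polynomial.derivative f) := by
  rw [Derivation.map_aeval]; simp

theorem constantCoeff_aeval_X (f : Polynomial ℝ) :
    constantCoeff (Polynomial.aeval (X (0 : Fin 1)) f : MvPolynomial (Fin 1) ℝ) = f.coeff 0 := by
  induction f using Polynomial.induction_on' with
  | add p q hp hq => simp only [map_add, hp, hq, Polynomial.coeff_add]
  | monomial k a =>
    rcases k with _ | k <;> simp [Polynomial.aeval_monomial, Polynomial.coeff_monomial]

theorem constantCoeff_uniPoly (n : ℕ) : constantCoeff (uniPoly n) = 1 := by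
  rw [uniPoly, constantCoeff_aeval_X, coeff_zero_eulerianUni]

theorem jet₁_uniPoly (n : ℕ) : jet₁ (uniPoly n) 0 = e₁ n := by
  rw [jet₁, uniPoly, pderiv_aeval_X, constantCoeff_aeval_X, Polynomial.coeff_derivative, zero_add,
    coeff_one_eulerianUni]
  norm_num

theorem quad_uniPoly (n : ℕ) : quad (uniPoly n) 0 0 = ell₂ n := by
  rw [quad, jet₁_uniPoly, jet₂, uniPoly, pderiv_aeval_X, pderiv_aeval_X, constantCoeff_aeval_X,
    Polynomial.coeff_derivative, Polynomial.coeff_derivative, zero_add, coeff_two_eulerianUni, ell₂]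
  norm_num; ring

theorem cubic_uniPoly (n : ℕ) : cubic (uniPoly n) 0 0 0 = ell₃ n := by
  have h2 := quad_uniPoly n
  rw [quad, jet₁_uniPoly, ell₂] at h2
  have h2' : jet₂ (uniPoly n) 0 0 = 2 * e₂ n := by linarith
  rw [cubic, h2', jet₁_uniPoly, jet₃, uniPoly, pderiv_aeval_X, pderiv_aeval_X, pderiv_aeval_X,
    constantCoeff_aeval_X, Polynomial.coeff_derivative, Polynomial.coeff_derivative,
    Polynomial.coeff_derivative, zero_add, coeff_three_eulerianUni, ell₃]
  norm_num; ring

theorem totalDegree_uniPoly (n : ℕ) : (uniPoly n).totalDegree = n := by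
  apply le_antisymm
  · rw [uniPoly, Polynomial.aeval_eq_sum_range, natDegree_eulerianUni]
    refine totalDegree_finsetSum_le fun i hi => ?_
    refine (totalDegree_smul_le _ _).trans ?_
    rw [totalDegree_X_pow]
    exact Nat.lt_succ_iff.1 (Finset.mem_range.1 hi)
  · have h := MvPolynomial.aeval_natDegree_le (uniPoly n) le_rfl
      (fun _ : Fin 1 => (Polynomial.X : Polynomial ℝ)) (n := 1) (fun _ => by simp)
    have h2 : aeval (fun _ : Fin 1 => (Polynomial.X : Polynomial ℝ)) (uniPoly n) =
        eulerianUni n := by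
      rw [uniPoly, ← Polynomial.aeval_algHom_apply]; simp
    rw [h2, natDegree_eulerianUni, mul_one] at h
    exact h

theorem mem_uniRelaxation_iff (n : ℕ) (x : ℝ) :
    x ∈ uniRelaxation n ↔ ∀ a b : ℝ, 0 ≤ n * a ^ 2 + 2 * a * (e₁ n * b) + ell₂ n * (b * b) +
      x * (e₁ n * a ^ 2 + 2 * a * (ell₂ n * b) + ell₃ n * (b * b)) := by
  have key : ∀ v : Fin 2 → ℝ, v ⬝ᵥ (pencil (uniPoly n) (fun _ => x) *ᵥ v) =
      n * v 0 ^ 2 + 2 * v 0 * (e₁ n * v 1) + ell₂ n * (v 1 * v 1) +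
      x * (e₁ n * v 0 ^ 2 + 2 * v 0 * (ell₂ n * v 1) + ell₃ n * (v 1 * v 1)) := by
    intro v
    have hv : (Fin.cons (v 0) (fun _ : Fin 1 => v 1) : Fin (1 + 1) → ℝ) = v := by
      ext i; fin_cases i <;> rfl
    have hD := linD_cons (R := ℝ) (constantCoeff_uniPoly n) (v 0) (fun _ => v 1)
    have hN := linN_cons (R := ℝ) (constantCoeff_uniPoly n) (v 0) (fun _ => v 1)
    rw [hv] at hD hN
    simp only [Finset.univ_unique, Finset.sum_singleton, Fin.default_eq_zero, Fin.isValue,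
      jet₁_uniPoly, quad_uniPoly, cubic_uniPoly, totalDegree_uniPoly, Algebra.algebraMap_self,
      RingHom.id_apply] at hD hN
    rw [← hD, ← hN, linD, linN, pencil, ← Finset.smul_sum, Matrix.add_mulVec, Matrix.smul_mulVec,
      dotProduct_add, dotProduct_smul]
    simp
  have hsymm : (pencil (uniPoly n) (fun _ => x)).IsHermitian := by
    ext i j
    simp only [pencil, pencilConst, pencilCoeff, moldMatrix, Matrix.conjTranspose_apply,
      Matrix.add_apply, Matrix.sum_apply, Matrix.smul_apply, Matrix.map_apply,
      Matrix.vecMulVec_apply, mul_comm (moldVec 1 i) (moldVec 1 j), star_trivial]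
  constructor
  · intro h a b
    have h' : (pencil (uniPoly n) (fun _ => x)).PosSemidef := h
    have := h'.dotProduct_mulVec_nonneg ![a, b]
    rw [star_trivial, key] at this
    simpa using this
  · intro h
    refine Matrix.PosSemidef.of_dotProduct_mulVec_nonneg hsymm fun v => ?_
    rw [star_trivial]
    exact (h (v 0) (v 1)).trans_eq (key v).symm

end EulerianRelaxation
end

/-! ### Exponential asymptotics, and the eigenvalue λ that equals un(n) for large n. -/

open scoped Matrix
noncomputable section
namespace EulerianRelaxation
open Filter Topology

/-! ### Exponential asymptotics -/

/-- `u m ~ l r^m`, with `u m = o(r^m)` if `l = 0`. -/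
def ExpLim (u : ℕ → ℝ) (r l : ℝ) : Prop := Tendsto (fun m => u m / r ^ m) atTop (𝓝 l)

namespace ExpLim

variable {u v : ℕ → ℝ} {r s l k : ℝ}

theorem cast (h : ExpLim u r l) (hr : r = s) (hl : l = k) (huv : ∀ᶠ m in atTop, u m = v m) :
    ExpLim v s k := by
  subst hr hl
  exact Tendsto.congr' (huv.mono fun m hm => by rw [hm]) h

theorem mul (hu : ExpLim u r l) (hv : ExpLim v s k) :
    ExpLim (fun m => u m * v m) (r * s) (l * k) :=
  (Tendsto.mul hu hv).congr fun m => by rw [div_mul_div_comm, mul_pow]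

theorem div (hu : ExpLim u r l) (hv : ExpLim v s k) (hk : k ≠ 0) :
    ExpLim (fun m => u m / v m) (r / s) (l / k) :=
  (Tendsto.div hu hv hk).congr fun m => by
    change u m / r ^ m / (v m / s ^ m) = u m / v m / (r / s) ^ m
    rw [div_div_div_comm, div_pow]

theorem add (hu : ExpLim u r l) (hv : ExpLim v r k) : ExpLim (fun m => u m + v m) r (l + k) :=
  (Tendsto.add hu hv).congr fun m => by rw [add_div]

theorem sub (hu : ExpLim u r l) (hv : ExpLim v r k) : ExpLim (fun m => u m - v m) r (l - k) :=
  (Tendsto.sub hu hv).congr fun m => by rw [sub_div]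

theorem const_mul (c : ℝ) (hu : ExpLim u r l) : ExpLim (fun m => c * u m) r (c * l) :=
  (Tendsto.const_mul c hu).congr fun m => by rw [mul_div_assoc]

theorem neg (hu : ExpLim u r l) : ExpLim (fun m => -u m) r (-l) :=
  (Tendsto.neg hu).congr fun m => by rw [neg_div]

theorem weaken (hu : ExpLim u r l) (hr : 0 < r) (hrs : r < s) : ExpLim u s 0 := by
  have hs := hr.trans hrs
  have h := Tendsto.mul hu (tendsto_pow_atTop_nhds_zero_of_lt_one (r := r / s)
    (by positivity) ((div_lt_one hs).2 hrs))
  rw [mul_zero] at h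
  refine h.congr fun m => ?_
  have : r ^ m ≠ 0 := by positivity
  rw [div_pow]; field_simp

theorem nat_mul (hu : ExpLim u r l) (hr : 0 < r) (hrs : r < s) :
    ExpLim (fun m => m * u m) s 0 := by
  have hs := hr.trans hrs
  have h := Tendsto.mul hu (tendsto_self_mul_const_pow_of_lt_one (r := r / s)
    (by positivity) ((div_lt_one hs).2 hrs))
  rw [mul_zero] at h
  refine h.congr fun m => ?_
  have : r ^ m ≠ 0 := by positivity
  rw [div_pow]; field_simp

theorem div_nat (hu : ExpLim u r l) : ExpLim (fun m => u m / m) r 0 := by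
  have h := Tendsto.mul hu (tendsto_one_div_atTop_nhds_zero_nat (𝕜 := ℝ))
  rw [mul_zero] at h
  exact h.congr fun m => by ring

theorem sqrt (hu : ExpLim u (r ^ 2) l) (hr : 0 ≤ r) : ExpLim (fun m => √(u m)) r √l :=
  (Tendsto.sqrt hu).congr fun m => by
    rw [Real.sqrt_div' _ (by positivity), ← pow_mul, mul_comm 2 m, pow_mul,
      Real.sqrt_sq (by positivity)]

theorem squeeze (hv : ExpLim v r 0) (hr : 0 < r) (huv : ∀ᶠ m in atTop, |u m| ≤ v m) :
    ExpLim u r 0 := by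
  refine squeeze_zero_norm' (huv.mono fun m hm => ?_) hv
  rw [Real.norm_eq_abs, abs_div, abs_of_pos (pow_pos hr m)]
  gcongr

theorem eventually_pos (hu : ExpLim u r l) (hr : 0 < r) (hl : 0 < l) : ∀ᶠ m in atTop, 0 < u m :=
  (Tendsto.eventually_const_lt hl hu).mono fun m hm => (div_pos_iff_of_pos_right (pow_pos hr m)).1 hm

theorem pow_self (hr : r ≠ 0) : ExpLim (fun m => r ^ m) r 1 :=
  tendsto_const_nhds.congr fun m => (div_self (pow_ne_zero m hr)).symm

theorem const (c : ℝ) : ExpLim (fun _ => c) 1 c := by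
  simp [ExpLim]

theorem nat (hs : 1 < s) : ExpLim (fun m => (m : ℝ)) s 0 := by
  simpa using (const 1).nat_mul one_pos hs

end ExpLim

/-! ### The smaller root of a perturbed quadratic -/

section Root

variable {A B C : ℕ → ℝ}

theorem eventually_mul_div_cancel (u : ℕ → ℝ) : ∀ᶠ m : ℕ in atTop, (m : ℝ) * (u m / m) = u m :=
  (eventually_ne_atTop 0).mono fun m hm => by
    have : (m : ℝ) ≠ 0 := Nat.cast_ne_zero.2 hm
    field_simp

theorem eventually_pos_of_div {u : ℕ → ℝ} {r l : ℝ} (hu : ExpLim (fun m => u m / m) r l)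
    (hr : 0 < r) (hl : 0 < l) : ∀ᶠ m in atTop, 0 < u m := by
  filter_upwards [hu.eventually_pos hr hl, eventually_gt_atTop 0] with m h hm
  exact (div_pos_iff_of_pos_right (Nat.cast_pos.2 hm)).1 h

/-- B² dominates because 16·144 < 64². -/
theorem expLim_disc (hA : ExpLim (fun m => A m / m) 16 8) (hB : ExpLim (fun m => B m / m) 64 16)
    (hC : ExpLim C 144 12) :
    ExpLim (fun m => (B m ^ 2 - 4 * A m * C m) / m ^ 2) (64 ^ 2) 256 := by
  have h1 := (((hA.mul hC).const_mul 4).weaken (by norm_num) (show _ < 64 * 64 by norm_num)).div_nat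
  refine ((hB.mul hB).sub h1).cast (by norm_num) (by norm_num) ?_
  filter_upwards [eventually_ne_atTop 0] with m hm
  have : (m : ℝ) ≠ 0 := Nat.cast_ne_zero.2 hm
  field_simp

theorem eventually_disc_nonneg (hA : ExpLim (fun m => A m / m) 16 8)
    (hB : ExpLim (fun m => B m / m) 64 16) (hC : ExpLim C 144 12) :
    ∀ᶠ m in atTop, 0 ≤ B m ^ 2 - 4 * A m * C m := by
  filter_upwards [(expLim_disc hA hB hC).eventually_pos (by norm_num) (by norm_num),
    eventually_gt_atTop 0] with m h hm
  have : (0 : ℝ) < m := Nat.cast_pos.2 hm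
  exact ((div_pos_iff_of_pos_right (by positivity)).1 h).le

theorem expLim_sqrt_disc (hA : ExpLim (fun m => A m / m) 16 8)
    (hB : ExpLim (fun m => B m / m) 64 16) (hC : ExpLim C 144 12) :
    ExpLim (fun m => √(B m ^ 2 - 4 * A m * C m) / m) 64 16 := by
  refine ((expLim_disc hA hB hC).sqrt (by norm_num)).cast rfl ?_ (.of_forall fun m => ?_)
  · rw [show (256 : ℝ) = 16 ^ 2 by norm_num, Real.sqrt_sq (by norm_num)]
  · rw [Real.sqrt_div' _ (by positivity), Real.sqrt_sq (by positivity)]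

/-- The numerator −B + √disc cancels to leading order, so the root is rewritten as −2C/(B + √disc).
This gives the rate 144/64 = 9/4 and the constant −24/32. -/
theorem expLim_root (hA : ExpLim (fun m => A m / m) 16 8)
    (hB : ExpLim (fun m => B m / m) 64 16) (hC : ExpLim C 144 12) :
    ExpLim (fun m => m * ((-B m + √(B m ^ 2 - 4 * A m * C m)) / (2 * A m))) (9 / 4) (-3 / 4) := by
  refine ((hC.const_mul (-2)).div (hB.add (expLim_sqrt_disc hA hB hC)) (by norm_num)).cast
    (by norm_num) (by norm_num) ?_
  filter_upwards [eventually_disc_nonneg hA hB hC, eventually_gt_atTop 0,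
    eventually_pos_of_div hA (by norm_num) (by norm_num),
    eventually_pos_of_div hB (by norm_num) (by norm_num)] with m hd hm hA hB
  have : (0 : ℝ) < m := Nat.cast_pos.2 hm
  have hs := Real.sq_sqrt hd
  have hs0 := Real.sqrt_nonneg (B m ^ 2 - 4 * A m * C m)
  set S := √(B m ^ 2 - 4 * A m * C m)
  have hBS : B m + S ≠ 0 := by positivity
  rw [← add_div]
  field_simp
  linear_combination -hs

end Root

/-! ### The univariate bound -/

/-- The determinant of the constant coefficient of the univariate pencil. -/
def detA (n : ℕ) : ℝ := n * ell₂ n - e₁ n ^ 2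

/-- The mixed coefficient of the determinant of the univariate pencil. -/
def detB (n : ℕ) : ℝ := n * ell₃ n - e₁ n * ell₂ n

/-- The determinant of the linear coefficient of the univariate pencil. -/
def detC (n : ℕ) : ℝ := e₁ n * ell₃ n - ell₂ n ^ 2

/-- The larger generalized eigenvalue of the univariate pencil. -/
def lam (n : ℕ) : ℝ := (detB n + √(detB n ^ 2 - 4 * detA n * detC n)) / (2 * detA n)

/-- The first entry of the generalized eigenvector `(y, 1)` for the larger eigenvalue. -/
def yOpt (n : ℕ) : ℝ := (-detB n + √(detB n ^ 2 - 4 * detA n * detC n)) / (2 * detA n)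

theorem lam_quadratic {n : ℕ} (hA : detA n ≠ 0) (hd : 0 ≤ detB n ^ 2 - 4 * detA n * detC n) :
    detA n * lam n ^ 2 - detB n * lam n + detC n = 0 := by
  have hs := Real.sq_sqrt hd
  rw [lam]
  set S := √(detB n ^ 2 - 4 * detA n * detC n)
  field_simp
  linear_combination hs

theorem yOpt_quadratic {n : ℕ} (hA : detA n ≠ 0) (hd : 0 ≤ detB n ^ 2 - 4 * detA n * detC n) :
    detA n * yOpt n ^ 2 + detB n * yOpt n + detC n = 0 := by
  have hs := Real.sq_sqrt hd
  rw [yOpt]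
  set S := √(detB n ^ 2 - 4 * detA n * detC n)
  field_simp
  linear_combination hs

/-- The first row of the kernel equation for λM₀ − M₁ at (y₀, 1). It follows from y₀ = λ − B/A: y₀
is minus the other root of At² − Bt + C. -/
theorem yOpt_eq {n : ℕ} (hA : detA n ≠ 0) (hd : 0 ≤ detB n ^ 2 - 4 * detA n * detC n) :
    (n * lam n - e₁ n) * yOpt n = ell₂ n - lam n * e₁ n := by
  have h := lam_quadratic hA hd
  have hy : detA n * yOpt n = detA n * lam n - detB n := by
    rw [yOpt, lam]; field_simp; ring
  have hL : e₁ n * detB n - n * detC n = detA n * ell₂ n := by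
    rw [detA, detB, detC]; ring
  apply mul_left_cancel₀ hA
  linear_combination (n * lam n - e₁ n) * hy + n * h + hL

theorem lam_quadratic' {n : ℕ} (hA : detA n ≠ 0) (hd : 0 ≤ detB n ^ 2 - 4 * detA n * detC n) :
    (n * lam n - e₁ n) * (ell₂ n * lam n - ell₃ n) = (e₁ n * lam n - ell₂ n) ^ 2 := by
  have h := lam_quadratic hA hd
  rw [detA, detB, detC] at h
  linear_combination h

/-- λM₀ − M₁ is singular with kernel spanned by (y₀, 1), so its quadratic form is a multiple of one
square. This determines the univariate relaxation and also measures the loss from replacing y₀ by y.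
-/
theorem rayleigh_eq {n : ℕ} (hA : detA n ≠ 0) (hd : 0 ≤ detB n ^ 2 - 4 * detA n * detC n)
    (hp : n * lam n - e₁ n ≠ 0) (a b : ℝ) :
    lam n * (n * a ^ 2 + 2 * a * (e₁ n * b) + ell₂ n * (b * b)) -
      (e₁ n * a ^ 2 + 2 * a * (ell₂ n * b) + ell₃ n * (b * b)) =
        (n * lam n - e₁ n) * (a - yOpt n * b) ^ 2 := by
  have h1 := yOpt_eq hA hd
  have h2 := lam_quadratic' hA hd
  have h3 : ell₂ n * lam n - ell₃ n = (n * lam n - e₁ n) * yOpt n ^ 2 := by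
    apply mul_left_cancel₀ hp
    linear_combination h2 - ((n * lam n - e₁ n) * yOpt n + (ell₂ n - lam n * e₁ n)) * h1
  linear_combination b ^ 2 * h3 + 2 * a * b * h1

/-- The square in `rayleigh_eq` shows that −1/λ is feasible; the inequality given by the vector (y₀,
1), where the square vanishes, excludes everything smaller. -/
theorem isLeast_uniRelaxation {n : ℕ} (hn : 0 < n) (hA : 0 < detA n)
    (hd : 0 ≤ detB n ^ 2 - 4 * detA n * detC n) (hl : 0 < lam n) (hp : 0 < n * lam n - e₁ n) :
    IsLeast (uniRelaxation n) (-1 / lam n) := by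
  have hr := rayleigh_eq hA.ne' hd hp.ne'
  constructor
  · rw [mem_uniRelaxation_iff]
    intro a b
    have h := hr a b
    have : 0 ≤ ((n * lam n - e₁ n) * (a - yOpt n * b) ^ 2) / lam n := by positivity
    rw [← h] at this
    convert this using 1
    field_simp
    ring
  · intro x hx
    rw [mem_uniRelaxation_iff] at hx
    have h := hr (yOpt n) 1
    have hx' := hx (yOpt n) 1
    set D := (n : ℝ) * yOpt n ^ 2 + 2 * yOpt n * (e₁ n * 1) + ell₂ n * (1 * 1) with hDdef
    have hn' : (0 : ℝ) < n := Nat.cast_pos.2 hn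
    have hD : 0 < D := by
      -- Completing the square: positivity of the determinant `detA` makes D positive.
      have : (n : ℝ) * D = (n * yOpt n + e₁ n) ^ 2 + detA n := by rw [hDdef, detA]; ring
      have h2 : 0 < (n : ℝ) * D := by rw [this]; positivity
      exact pos_of_mul_pos_right h2 hn'.le
    have hN : e₁ n * yOpt n ^ 2 + 2 * yOpt n * (ell₂ n * 1) + ell₃ n * (1 * 1) = lam n * D := by
      linear_combination -h
    rw [hN] at hx'
    have h3 : 0 ≤ D * (1 + x * lam n) := by linarith
    have h4 : 0 ≤ 1 + x * lam n := nonneg_of_mul_nonneg_right h3 hD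
    rw [div_le_iff₀ hl]
    linarith

theorem un_eq_lam {n : ℕ} (hl : 0 < lam n) (h : IsLeast (uniRelaxation n) (-1 / lam n)) :
    un n = lam n := by
  rw [un, h.csInf_eq]
  field_simp

theorem pow_two_mul_add_one (a : ℝ) (m : ℕ) : a ^ (2 * m + 1) = a * (a ^ 2) ^ m := by
  rw [pow_succ, pow_mul, mul_comm]

theorem e₁_two_mul (m : ℕ) : e₁ (2 * m) = 2 * 4 ^ m - (2 * m + 2) := by
  rw [e₁, pow_two_mul_add_one]; push_cast; norm_num

theorem e₂_two_mul (m : ℕ) :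
    e₂ (2 * m) = 3 * 9 ^ m - (4 * m + 4) * 4 ^ m + (2 * m + 1) * (m + 1) := by
  rw [e₂, pow_two_mul_add_one, pow_two_mul_add_one]; push_cast; norm_num; ring

theorem e₃_two_mul (m : ℕ) :
    e₃ (2 * m) = 4 * 16 ^ m - (6 * m + 6) * 9 ^ m + (2 * m + 1) * (m + 1) * 2 * 4 ^ m -
      2 * m * (2 * m + 1) * (m + 1) / 3 := by
  rw [e₃, pow_two_mul_add_one, pow_two_mul_add_one, pow_two_mul_add_one]; push_cast; norm_num; ring

theorem expLim_affine (a b : ℝ) {s : ℝ} (hs : 1 < s) : ExpLim (fun m => a * m + b) s 0 :=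
  (((ExpLim.nat hs).const_mul a).add ((ExpLim.const b).weaken one_pos hs)).cast rfl (by simp)
    (.of_forall fun _ => rfl)

theorem expLim_e₁ : ExpLim (fun m => e₁ (2 * m)) 4 2 :=
  (((ExpLim.pow_self (by norm_num)).const_mul 2).sub
    (expLim_affine 2 2 (by norm_num))).cast rfl (by norm_num)
    (.of_forall fun m => (e₁_two_mul m).symm)

theorem expLim_e₂ : ExpLim (fun m => e₂ (2 * m)) 9 3 := by
  have h1 := (expLim_affine 4 4 (show (1 : ℝ) < 2 by norm_num)).mul
    (ExpLim.pow_self (show (4 : ℝ) ≠ 0 by norm_num))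
  have h2 := (expLim_affine 2 1 (show (1 : ℝ) < 2 by norm_num)).mul
    (expLim_affine 1 1 (show (1 : ℝ) < 2 by norm_num))
  refine ((((ExpLim.pow_self (show (9 : ℝ) ≠ 0 by norm_num)).const_mul 3).sub
    (h1.weaken (by norm_num) (by norm_num))).add
    (h2.weaken (by norm_num) (by norm_num))).cast rfl (by norm_num) (.of_forall fun m => ?_)
  rw [e₂_two_mul]; ring

theorem expLim_e₃ : ExpLim (fun m => e₃ (2 * m)) 16 4 := by
  have h1 := (expLim_affine 6 6 (show (1 : ℝ) < 3 / 2 by norm_num)).mul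
    (ExpLim.pow_self (show (9 : ℝ) ≠ 0 by norm_num))
  have h2 := (expLim_affine 2 1 (show (1 : ℝ) < 3 / 2 by norm_num)).mul
    (expLim_affine 1 1 (show (1 : ℝ) < 3 / 2 by norm_num))
  have h3 := (h2.mul (ExpLim.pow_self (show (4 : ℝ) ≠ 0 by norm_num))).const_mul 2
  have h4 := (h2.mul (expLim_affine 1 0 (show (1 : ℝ) < 3 / 2 by norm_num))).const_mul (2 / 3)
  refine (((((ExpLim.pow_self (show (16 : ℝ) ≠ 0 by norm_num)).const_mul 4).sub
    (h1.weaken (by norm_num) (by norm_num))).add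
    (h3.weaken (by norm_num) (by norm_num))).sub
    (h4.weaken (by norm_num) (by norm_num))).cast rfl (by norm_num) (.of_forall fun m => ?_)
  rw [e₃_two_mul]; ring

theorem expLim_ell₂ : ExpLim (fun m => ell₂ (2 * m)) 16 4 :=
  ((expLim_e₁.mul expLim_e₁).sub ((expLim_e₂.const_mul 2).weaken (by norm_num)
    (by norm_num))).cast (by norm_num) (by norm_num) (.of_forall fun m => by rw [ell₂]; ring)

theorem expLim_ell₃ : ExpLim (fun m => ell₃ (2 * m)) 64 8 :=
  ((((expLim_e₁.mul expLim_e₁).mul expLim_e₁).sub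
    (((expLim_e₁.mul expLim_e₂).const_mul 3).weaken (by norm_num) (by norm_num))).add
    ((expLim_e₃.const_mul 3).weaken (by norm_num) (by norm_num))).cast (by norm_num) (by norm_num)
    (.of_forall fun m => by rw [ell₃]; ring)

theorem expLim_detA : ExpLim (fun m => detA (2 * m) / m) 16 8 := by
  refine ((expLim_ell₂.const_mul 2).sub
    ((expLim_e₁.mul expLim_e₁).div_nat.cast (s := 16) (by norm_num) rfl
      (.of_forall fun _ => rfl))).cast rfl (by norm_num) ?_
  filter_upwards [eventually_ne_atTop 0] with m hm
  have : (m : ℝ) ≠ 0 := Nat.cast_ne_zero.2 hm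
  rw [detA]; push_cast; field_simp

theorem expLim_detB : ExpLim (fun m => detB (2 * m) / m) 64 16 := by
  refine ((expLim_ell₃.const_mul 2).sub
    ((expLim_e₁.mul expLim_ell₂).div_nat.cast (s := 64) (by norm_num) rfl
      (.of_forall fun _ => rfl))).cast rfl (by norm_num) ?_
  filter_upwards [eventually_ne_atTop 0] with m hm
  have : (m : ℝ) ≠ 0 := Nat.cast_ne_zero.2 hm
  rw [detB]; push_cast; field_simp

theorem expLim_detC : ExpLim (fun m => detC (2 * m)) 144 12 := by
  refine ((((expLim_e₁.mul expLim_e₁).mul expLim_e₂).add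
    (((expLim_e₁.mul expLim_e₃).const_mul 3).weaken (by norm_num) (by norm_num))).sub
    (((expLim_e₂.mul expLim_e₂).const_mul 4).weaken (by norm_num) (by norm_num))).cast
      (by norm_num) (by norm_num) (.of_forall fun m => ?_)
  rw [detC, ell₂, ell₃]; ring

theorem eventually_detA_pos : ∀ᶠ m in atTop, 0 < detA (2 * m) :=
  eventually_pos_of_div expLim_detA (by norm_num) (by norm_num)

theorem eventually_uni_disc_nonneg :
    ∀ᶠ m in atTop, 0 ≤ detB (2 * m) ^ 2 - 4 * detA (2 * m) * detC (2 * m) :=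
  eventually_disc_nonneg expLim_detA expLim_detB expLim_detC

theorem expLim_yOpt : ExpLim (fun m => m * yOpt (2 * m)) (9 / 4) (-3 / 4) :=
  expLim_root expLim_detA expLim_detB expLim_detC

theorem expLim_lam : ExpLim (fun m => lam (2 * m)) 4 2 := by
  refine ((expLim_detB.add (expLim_sqrt_disc expLim_detA expLim_detB expLim_detC)).div
    (expLim_detA.const_mul 2) (by norm_num)).cast (by norm_num) (by norm_num) ?_
  filter_upwards [eventually_ne_atTop 0] with m hm
  have : (m : ℝ) ≠ 0 := Nat.cast_ne_zero.2 hm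
  rw [lam, ← add_div, ← mul_div_assoc, div_div_div_cancel_right₀ this]

theorem expLim_lam_gap : ExpLim (fun m => (2 * m * lam (2 * m) - e₁ (2 * m)) / m) 4 4 := by
  refine ((expLim_lam.const_mul 2).sub expLim_e₁.div_nat).cast rfl (by norm_num) ?_
  filter_upwards [eventually_ne_atTop 0] with m hm
  have : (m : ℝ) ≠ 0 := Nat.cast_ne_zero.2 hm
  field_simp

theorem eventually_lam_gap_pos :
    ∀ᶠ m in atTop, 0 < ((2 * m : ℕ) : ℝ) * lam (2 * m) - e₁ (2 * m) :=
  (eventually_pos_of_div expLim_lam_gap (by norm_num) (by norm_num)).mono fun m h => by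
    push_cast; exact h

/-- For q(t) = At² − Bt + C with roots λ and λ′, e₁ − λ = q(e₁)/(A(e₁ − λ′)), and 2A(e₁ − λ′) = 2Ae₁
− B + √disc does not cancel. In q(e₁) the leading terms do cancel identically, leaving one governed
by e₁²e₂. -/
theorem expLim_e₁_sub_lam : ExpLim (fun m => e₁ (2 * m) - lam (2 * m)) (9 / 4) (3 / 2) := by
  have h1 := expLim_e₁.mul ((expLim_e₁.mul expLim_e₂).sub
    ((expLim_e₃.const_mul 3).weaken (by norm_num) (show _ < 4 * 9 by norm_num)))
  have h2 := (((expLim_e₂.mul expLim_e₂).const_mul 4).weaken (by norm_num)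
    (show _ < 4 * (4 * 9) by norm_num)).div_nat
  have hnum := ((h1.const_mul 2).sub h1.div_nat).sub h2
  have hden := (((expLim_detA.mul expLim_e₁).const_mul 2).sub
    (expLim_detB.cast (s := 16 * 4) (by norm_num) rfl (.of_forall fun _ => rfl))).add
    ((expLim_sqrt_disc expLim_detA expLim_detB expLim_detC).cast (s := 16 * 4) (by norm_num) rfl
      (.of_forall fun _ => rfl))
  refine ((hnum.const_mul 2).div hden (by norm_num)).cast (by norm_num) (by norm_num) ?_
  filter_upwards [eventually_uni_disc_nonneg, eventually_gt_atTop 0, eventually_detA_pos,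
    hden.eventually_pos (by norm_num) (by norm_num)] with m hd hm hA hpos
  have hm' : (0 : ℝ) < m := Nat.cast_pos.2 hm
  have hs := Real.sq_sqrt hd
  rw [lam]
  set S := √(detB (2 * m) ^ 2 - 4 * detA (2 * m) * detC (2 * m))
  have hpos' : 0 < 2 * detA (2 * m) * e₁ (2 * m) - detB (2 * m) + S := by
    have := mul_pos hpos hm'
    field_simp at this
    linarith
  have hq : detA (2 * m) * e₁ (2 * m) ^ 2 - detB (2 * m) * e₁ (2 * m) + detC (2 * m) =
      (2 * m - 1) * (e₁ (2 * m) * (e₁ (2 * m) * e₂ (2 * m) - 3 * e₃ (2 * m))) -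
        4 * (e₂ (2 * m) * e₂ (2 * m)) := by
    rw [detA, detB, detC, ell₂, ell₃]; push_cast; ring
  have e1 : 2 * (2 * (e₁ (2 * m) * (e₁ (2 * m) * e₂ (2 * m) - 3 * e₃ (2 * m))) -
      e₁ (2 * m) * (e₁ (2 * m) * e₂ (2 * m) - 3 * e₃ (2 * m)) / m -
      4 * (e₂ (2 * m) * e₂ (2 * m)) / m) =
      2 * (detA (2 * m) * e₁ (2 * m) ^ 2 - detB (2 * m) * e₁ (2 * m) + detC (2 * m)) / m := by
    rw [hq]; field_simp
  have e2 : 2 * (detA (2 * m) / m * e₁ (2 * m)) - detB (2 * m) / m + S / m =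
      (2 * detA (2 * m) * e₁ (2 * m) - detB (2 * m) + S) / m := by
    field_simp
  rw [e1, e2, div_div_div_cancel_right₀ hm'.ne', div_eq_iff hpos'.ne']
  field_simp
  linear_combination hs

/-- Bootstrapping: singularity gives λ − ℓ₃/ℓ₂ = (e₁λ − ℓ₂)²/(ℓ₂(nλ − e₁)), and the previous
estimate of e₁ − λ makes this O((81/64)^m/m). Next, ℓ₃/ℓ₂ = e₁ − e₂/e₁ + O((81/64)^m), and e₂/e₁ is
expanded. Precision o(2^m) suffices because λ will multiply a quantity that is o(9^m). -/
theorem expLim_lam_expansion :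
    ExpLim (fun m => lam (2 * m) - (2 * 4 ^ m - 3 / 2 * (9 / 4) ^ m)) 2 0 := by
  have h1 : ExpLim (fun m => (e₁ (2 * m) * lam (2 * m) - ell₂ (2 * m))) 9 3 := by
    refine ((expLim_e₂.const_mul 2).sub ((expLim_e₁.mul expLim_e₁_sub_lam).cast (s := 9)
      (by norm_num) rfl (.of_forall fun _ => rfl))).cast rfl (by norm_num) (.of_forall fun m => ?_)
    rw [ell₂]; ring
  have h2 := ((h1.mul h1).div (expLim_ell₂.mul expLim_lam_gap) (by norm_num)).div_nat.weaken
    (by norm_num) (show _ < (2 : ℝ) by norm_num)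
  have h3 := (((expLim_e₂.mul expLim_e₂).const_mul 2).sub
    (((expLim_e₁.mul expLim_e₃).const_mul 3).weaken (by norm_num)
      (show _ < (9 * 9 : ℝ) by norm_num))).div (expLim_e₁.mul expLim_ell₂) (by norm_num)
  have h3' := h3.weaken (by norm_num) (show _ < (2 : ℝ) by norm_num)
  have h4a := (expLim_affine 2 2 (show (1 : ℝ) < 2 by norm_num)).mul
    (ExpLim.pow_self (show (9 / 4 : ℝ) ≠ 0 by norm_num))
  have h4b := (expLim_affine 4 4 (show (1 : ℝ) < 5 / 4 by norm_num)).mul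
    (ExpLim.pow_self (show (4 : ℝ) ≠ 0 by norm_num))
  have h4c := (expLim_affine 2 1 (show (1 : ℝ) < 2 by norm_num)).mul
    (expLim_affine 1 1 (show (1 : ℝ) < 2 by norm_num))
  have h4 := (((((h4a.const_mul (3 / 2)).weaken (by norm_num) (show _ < (6 : ℝ) by norm_num)).sub
    (h4b.weaken (by norm_num) (by norm_num))).add
    (h4c.weaken (by norm_num) (by norm_num))).div expLim_e₁ (by norm_num)).weaken
      (by norm_num) (show _ < (2 : ℝ) by norm_num)
  have h5 := expLim_affine 2 2 (show (1 : ℝ) < 2 by norm_num)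
  refine ((((h2.sub h3').sub h4).sub h5)).cast rfl (by norm_num) ?_
  filter_upwards [eventually_gt_atTop 0, eventually_detA_pos, eventually_uni_disc_nonneg,
    eventually_lam_gap_pos, expLim_e₁.eventually_pos (by norm_num) (by norm_num),
    expLim_ell₂.eventually_pos (by norm_num) (by norm_num)] with m hm hA hd hg he hl
  have hm' : (0 : ℝ) < m := Nat.cast_pos.2 hm
  have hq := lam_quadratic' hA.ne' hd
  have e1 : e₁ (2 * m) = 2 * 4 ^ m - (2 * m + 2) := e₁_two_mul m
  have e2 := e₂_two_mul m
  push_cast at hq hg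
  have p94 : (9 / 4 : ℝ) ^ m * 4 ^ m = 9 ^ m := by rw [← mul_pow]; norm_num
  have t1 : (e₁ (2 * m) * lam (2 * m) - ell₂ (2 * m)) * (e₁ (2 * m) * lam (2 * m) - ell₂ (2 * m)) /
      (ell₂ (2 * m) * ((2 * m * lam (2 * m) - e₁ (2 * m)) / m)) / m =
      lam (2 * m) - ell₃ (2 * m) / ell₂ (2 * m) := by
    rw [← pow_two, ← hq]
    field_simp
  have t2 : (2 * (e₂ (2 * m) * e₂ (2 * m)) - 3 * (e₁ (2 * m) * e₃ (2 * m))) /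
      (e₁ (2 * m) * ell₂ (2 * m)) =
      e₁ (2 * m) - ell₃ (2 * m) / ell₂ (2 * m) - e₂ (2 * m) / e₁ (2 * m) := by
    field_simp
    rw [ell₂, ell₃]; ring
  have t3 : (3 / 2 * ((2 * m + 2) * (9 / 4) ^ m) - (4 * m + 4) * 4 ^ m + (2 * m + 1) * (1 * m + 1)) /
      e₁ (2 * m) = e₂ (2 * m) / e₁ (2 * m) - 3 / 2 * (9 / 4) ^ m := by
    rw [eq_sub_iff_add_eq, div_add' _ _ _ he.ne']
    congr 1
    rw [e1, e2]
    linear_combination 3 * p94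
  rw [t1, t2, t3, e1]
  ring

end EulerianRelaxation
end

/-! ### Perturbations of the all-ones vector, and the first entry y. -/

open scoped Matrix
noncomputable section
namespace EulerianRelaxation
open Filter Topology

/-! ### Perturbations of the all-ones vector -/

section Perturbation

variable {n : ℕ} (d : Fin n → ℝ)

/-- `L(x_i s)` for `s = x₁ + ⋯ + xₙ`. -/
def rowQuad (n : ℕ) (i : Fin n) : ℝ := ∑ k, quad (eulerian n) k i

/-- `L(x_i x_j s)` for `s = x₁ + ⋯ + xₙ`. -/
def rowCubic (n : ℕ) (i j : Fin n) : ℝ := ∑ k, cubic (eulerian n) k i j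

/-- `L(δ)` for the linear form `δ` with coefficients `d`. -/
def pertJ : ℝ := ∑ i, jet₁ (eulerian n) i * d i

/-- `L(δ s)` for the linear form `δ` with coefficients `d`. -/
def pertQ : ℝ := ∑ i, rowQuad n i * d i

/-- `L(δ²)` for the linear form `δ` with coefficients `d`. -/
def pertQQ : ℝ := ∑ i, ∑ j, quad (eulerian n) i j * (d i * d j)

/-- `L(δ s²)` for the linear form `δ` with coefficients `d`. -/
def pertR : ℝ := ∑ i, (∑ j, rowCubic n i j) * d i

/-- `L(δ² s)` for the linear form `δ` with coefficients `d`. -/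
def pertRR : ℝ := ∑ i, ∑ j, rowCubic n i j * (d i * d j)

theorem rowCubic_comm (i j : Fin n) : rowCubic n i j = rowCubic n j i :=
  Finset.sum_congr rfl fun k _ => cubic_swap_right _ k i j

theorem sum_sum_one_sub (M : Fin n → Fin n → ℝ) (hM : ∀ i j, M i j = M j i) :
    ∑ i, ∑ j, M i j * ((1 - d i) * (1 - d j)) =
      ∑ i, ∑ j, M i j - 2 * ∑ i, (∑ j, M i j) * d i + ∑ i, ∑ j, M i j * (d i * d j) := by
  have h1 : ∑ i, ∑ j, M i j * d i = ∑ i, (∑ j, M i j) * d i := by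
    simp only [Finset.sum_mul]
  have h2 : ∑ i, ∑ j, M i j * d j = ∑ i, (∑ j, M i j) * d i := by
    rw [Finset.sum_comm, ← h1]
    exact Finset.sum_congr rfl fun i _ => Finset.sum_congr rfl fun j _ => by rw [hM]
  have h3 : ∀ i j, M i j * ((1 - d i) * (1 - d j)) =
      M i j - M i j * d i - M i j * d j + M i j * (d i * d j) := fun i j => by ring
  simp only [h3, Finset.sum_add_distrib, Finset.sum_sub_distrib, h1, h2]
  ring

theorem sum_quad_one_sub : ∑ i, ∑ j, quad (eulerian n) i j * ((1 - d i) * (1 - d j)) =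
    ell₂ n - 2 * pertQ d + pertQQ d := by
  have h : ∀ i, ∑ j, quad (eulerian n) i j = rowQuad n i := fun i =>
    Finset.sum_congr rfl fun j _ => quad_comm _ i j
  rw [sum_sum_one_sub d _ (quad_comm _), sum_quad_eulerian, pertQ, pertQQ]
  simp only [h]

theorem sum_rowCubic : ∑ i, ∑ j, rowCubic n i j = ell₃ n := by
  rw [← sum_cubic_eulerian]
  refine Finset.sum_congr rfl fun i _ => Finset.sum_congr rfl fun j _ =>
    Finset.sum_congr rfl fun k _ => ?_
  rw [cubic_swap_left, cubic_swap_right]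

theorem sum_rowCubic_one_sub : ∑ i, ∑ j, rowCubic n i j * ((1 - d i) * (1 - d j)) =
    ell₃ n - 2 * pertR d + pertRR d := by
  rw [sum_sum_one_sub d _ rowCubic_comm, sum_rowCubic, pertR, pertRR]

theorem sum_jet₁_one_sub : ∑ i, jet₁ (eulerian n) i * (1 - d i) = e₁ n - pertJ d := by
  simp only [mul_sub, mul_one, Finset.sum_sub_distrib, sum_jet₁_eulerian, pertJ]

theorem sum_rowQuad_one_sub : ∑ i, rowQuad n i * (1 - d i) = ell₂ n - pertQ d := by
  simp only [mul_sub, mul_one, Finset.sum_sub_distrib, pertQ]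
  congr 1
  rw [← sum_quad_eulerian, Finset.sum_comm]
  rfl

/-- Stated for any algebra R and scalar c to serve both vectors: c = 1 over ℝ for `newVec`, and c =
−1 over ℝ[Y] for `oldVec`. -/
theorem linD_one_sub {R : Type*} [CommRing R] [Algebra ℝ R] (y : R) (c : ℝ) :
    linD (eulerian n) (Fin.cons y fun i => algebraMap ℝ R (c * (1 - d i)) : Fin (n + 1) → R) =
      algebraMap ℝ R n * y ^ 2 + 2 * y * algebraMap ℝ R (c * (e₁ n - pertJ d)) +
        algebraMap ℝ R (c ^ 2 * (ell₂ n - 2 * pertQ d + pertQQ d)) := by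
  rw [linD_cons (constantCoeff_eulerian n), totalDegree_eulerian, ← sum_quad_one_sub,
    ← sum_jet₁_one_sub, Finset.mul_sum, Finset.mul_sum]
  simp only [Finset.mul_sum, map_sum, ← map_mul, map_natCast]
  refine congrArg₂ _ (congrArg₂ _ rfl (Finset.sum_congr rfl fun i _ => ?_))
    (Finset.sum_congr rfl fun i _ => Finset.sum_congr rfl fun j _ => ?_)
  · congr 2; ring
  · congr 1; ring

theorem linN_one_sub {R : Type*} [CommRing R] [Algebra ℝ R] (y : R) (c : ℝ) :
    linN (eulerian n) (Fin.cons y fun i => algebraMap ℝ R (c * (1 - d i)) : Fin (n + 1) → R) =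
      algebraMap ℝ R (e₁ n) * y ^ 2 + 2 * y * algebraMap ℝ R (c * (ell₂ n - pertQ d)) +
        algebraMap ℝ R (c ^ 2 * (ell₃ n - 2 * pertR d + pertRR d)) := by
  rw [linN_cons (constantCoeff_eulerian n), ← sum_rowCubic_one_sub, sum_jet₁_eulerian,
    ← sum_rowQuad_one_sub]
  change _ * _ + 2 * y * ∑ i, algebraMap ℝ R (rowQuad n i) * _ +
    ∑ i, ∑ j, algebraMap ℝ R (rowCubic n i j) * _ = _
  simp only [Finset.mul_sum, map_sum, ← map_mul]
  refine congrArg₂ _ (congrArg₂ _ rfl (Finset.sum_congr rfl fun i _ => ?_))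
    (Finset.sum_congr rfl fun i _ => Finset.sum_congr rfl fun j _ => ?_)
  · congr 2; ring
  · congr 1; ring

/-- The weight `∑ |d_i| 2^i` (with indices starting at `1`). -/
def weight : ℝ := ∑ i, |d i| * 2 ^ ((i : ℕ) + 1)

theorem sum_two_pow_le (n : ℕ) : ∑ k : Fin n, (2 : ℝ) ^ ((k : ℕ) + 1) ≤ 2 ^ (n + 1) := by
  rw [Fin.sum_univ_eq_sum_range (fun k => (2 : ℝ) ^ (k + 1))]
  have : ∑ k ∈ Finset.range n, (2 : ℝ) ^ (k + 1) = 2 ^ (n + 1) - 2 := by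
    induction n with
    | zero => simp
    | succ n ih => rw [Finset.sum_range_succ, ih]; ring
  rw [this]; linarith

theorem weight_nonneg : 0 ≤ weight d := Finset.sum_nonneg fun i _ => by positivity

theorem abs_jet₁_le (i : Fin n) : |jet₁ (eulerian n) i| ≤ 2 ^ ((i : ℕ) + 1) := by
  have h1 : (1 : ℝ) ≤ 2 ^ ((i : ℕ) + 1) := one_le_pow₀ (by norm_num)
  rw [jet₁_eulerian_eq, jet₁_eulerian i.2, abs_of_nonneg (by linarith)]
  linarith

theorem abs_quad_le (i j : Fin n) :
    |quad (eulerian n) i j| ≤ 2 ^ ((i : ℕ) + 1) * 2 ^ ((j : ℕ) + 1) := by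
  rw [quad_eulerian_eq]; exact abs_quad_eulerian_le i.2 j.2

theorem abs_rowQuad_le (i : Fin n) : |rowQuad n i| ≤ 2 ^ (n + 1) * 2 ^ ((i : ℕ) + 1) :=
  calc |rowQuad n i| ≤ ∑ k : Fin n, 2 ^ ((k : ℕ) + 1) * 2 ^ ((i : ℕ) + 1) :=
        (Finset.abs_sum_le_sum_abs _ _).trans (Finset.sum_le_sum fun k _ => abs_quad_le k i)
    _ ≤ _ := by rw [← Finset.sum_mul]; gcongr; exact sum_two_pow_le n

theorem abs_rowCubic_le (i j : Fin n) :
    |rowCubic n i j| ≤ 2 ^ (n + 1) * (2 ^ ((i : ℕ) + 1) * 2 ^ ((j : ℕ) + 1)) :=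
  calc |rowCubic n i j| ≤ ∑ k : Fin n, 2 ^ ((k : ℕ) + 1) * (2 ^ ((i : ℕ) + 1) * 2 ^ ((j : ℕ) + 1)) := by
        refine (Finset.abs_sum_le_sum_abs _ _).trans (Finset.sum_le_sum fun k _ => ?_)
        rw [cubic_eulerian_eq, ← mul_assoc]
        exact abs_cubic_eulerian_le k.2 i.2 j.2
    _ ≤ _ := by rw [← Finset.sum_mul]; gcongr; exact sum_two_pow_le n

theorem abs_sum_rowCubic_le (i : Fin n) :
    |∑ j, rowCubic n i j| ≤ 2 ^ (n + 1) * 2 ^ (n + 1) * 2 ^ ((i : ℕ) + 1) :=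
  calc |∑ j, rowCubic n i j|
      ≤ ∑ j : Fin n, 2 ^ (n + 1) * 2 ^ ((i : ℕ) + 1) * 2 ^ ((j : ℕ) + 1) :=
        (Finset.abs_sum_le_sum_abs _ _).trans (Finset.sum_le_sum fun j _ =>
          (abs_rowCubic_le i j).trans_eq (by ring))
    _ ≤ 2 ^ (n + 1) * 2 ^ ((i : ℕ) + 1) * 2 ^ (n + 1) := by
        rw [← Finset.mul_sum]; gcongr; exact sum_two_pow_le n
    _ = _ := by ring

theorem abs_sum_mul_le (f : Fin n → ℝ) (K : ℝ) (hf : ∀ i, |f i| ≤ K * 2 ^ ((i : ℕ) + 1)) :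
    |∑ i, f i * d i| ≤ K * weight d := by
  rw [weight, Finset.mul_sum]
  refine (Finset.abs_sum_le_sum_abs _ _).trans (Finset.sum_le_sum fun i _ => ?_)
  rw [abs_mul]
  calc |f i| * |d i| ≤ K * 2 ^ ((i : ℕ) + 1) * |d i| := by gcongr; exact hf i
    _ = _ := by ring

theorem abs_sum_sum_mul_le (f : Fin n → Fin n → ℝ) (K : ℝ)
    (hf : ∀ i j, |f i j| ≤ K * (2 ^ ((i : ℕ) + 1) * 2 ^ ((j : ℕ) + 1))) :
    |∑ i, ∑ j, f i j * (d i * d j)| ≤ K * weight d ^ 2 := by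
  rw [pow_two, weight, Finset.sum_mul_sum, Finset.mul_sum]
  simp only [Finset.mul_sum]
  refine (Finset.abs_sum_le_sum_abs _ _).trans (Finset.sum_le_sum fun i _ => ?_)
  refine (Finset.abs_sum_le_sum_abs _ _).trans (Finset.sum_le_sum fun j _ => ?_)
  rw [abs_mul, abs_mul]
  calc |f i j| * (|d i| * |d j|)
      ≤ K * (2 ^ ((i : ℕ) + 1) * 2 ^ ((j : ℕ) + 1)) * (|d i| * |d j|) := by gcongr; exact hf i j
    _ = _ := by ring

theorem abs_pertJ_le : |pertJ d| ≤ weight d :=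
  (abs_sum_mul_le d _ 1 fun i => by simpa using abs_jet₁_le i).trans_eq (one_mul _)

theorem abs_pertQ_le : |pertQ d| ≤ 2 ^ (n + 1) * weight d :=
  abs_sum_mul_le d _ _ abs_rowQuad_le

theorem abs_pertQQ_le : |pertQQ d| ≤ weight d ^ 2 :=
  (abs_sum_sum_mul_le d _ 1 fun i j => by simpa using abs_quad_le i j).trans_eq (one_mul _)

theorem abs_pertR_le : |pertR d| ≤ 2 ^ (n + 1) * 2 ^ (n + 1) * weight d :=
  abs_sum_mul_le d _ _ abs_sum_rowCubic_le

theorem abs_pertRR_le : |pertRR d| ≤ 2 ^ (n + 1) * weight d ^ 2 :=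
  abs_sum_sum_mul_le d _ _ abs_rowCubic_le

end Perturbation

/-! ### The choice of the first entry -/

/-- The perturbation turning `(1, …, 1)` into `(-1, 1, …, 1)`. -/
def flip (n : ℕ) : Fin n → ℝ := fun i => if (i : ℕ) = 0 then 2 else 0

theorem weight_flip_le (n : ℕ) : weight (flip n) ≤ 4 := by
  rcases n with _ | n
  · simp [weight]
  · rw [weight, Fin.sum_univ_succ]
    simp [flip]; norm_num

theorem oldVec_eq (n : ℕ) : oldVec n = Fin.cons Polynomial.X fun i =>
    algebraMap ℝ (Polynomial ℝ) (-1 * (1 - flip n i)) := by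
  ext1 k
  refine Fin.cases ?_ (fun i => ?_) k
  · simp [oldVec]
  · rw [Fin.cons_succ, flip, oldVec]
    simp only [Fin.val_succ, Nat.succ_ne_zero, if_false, Nat.add_eq_right]
    split_ifs <;> norm_num

/-- Half the leading coefficient of `critPoly`. -/
def critA (n : ℕ) : ℝ := n * (ell₂ n - pertQ (flip n)) - e₁ n * (e₁ n - pertJ (flip n))

/-- Minus half the linear coefficient of `critPoly`. -/
def critB (n : ℕ) : ℝ := n * (ell₃ n - 2 * pertR (flip n) + pertRR (flip n)) -
  e₁ n * (ell₂ n - 2 * pertQ (flip n) + pertQQ (flip n))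

/-- Half the constant coefficient of `critPoly`. -/
def critC (n : ℕ) : ℝ :=
  (e₁ n - pertJ (flip n)) * (ell₃ n - 2 * pertR (flip n) + pertRR (flip n)) -
    (ell₂ n - pertQ (flip n)) * (ell₂ n - 2 * pertQ (flip n) + pertQQ (flip n))

theorem critPoly_eq (n : ℕ) : critPoly n = Polynomial.C (2 * critA n) * Polynomial.X ^ 2 +
    Polynomial.C (-2 * critB n) * Polynomial.X + Polynomial.C (2 * critC n) := by
  rw [critPoly, oldVec_eq, linD_one_sub, linN_one_sub, critA, critB, critC]
  simp only [← Polynomial.C_eq_algebraMap, Polynomial.derivative_mul,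
    Polynomial.derivative_C, Polynomial.derivative_X_pow, Polynomial.derivative_X,
    Polynomial.derivative_ofNat, map_mul, map_sub, map_add, map_neg, map_pow, map_one, map_ofNat]
  simp only [Nat.cast_ofNat, show Polynomial.C (2 : ℝ) = 2 from map_ofNat _ 2]
  norm_num
  ring

theorem coeff_critPoly (n : ℕ) : (critPoly n).coeff 2 = 2 * critA n ∧
    (critPoly n).coeff 1 = -2 * critB n ∧ (critPoly n).coeff 0 = 2 * critC n := by
  rw [critPoly_eq]
  refine ⟨?_, ?_, ?_⟩ <;> simp [Polynomial.coeff_X, Polynomial.coeff_C, -map_mul, -map_neg]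

theorem critDisc_eq (n : ℕ) : critDisc n = 4 * (critB n ^ 2 - 4 * critA n * critC n) := by
  obtain ⟨h2, h1, h0⟩ := coeff_critPoly n
  rw [critDisc, h2, h1, h0]; ring

/-- The prescribed root carries +b although Y solves aY² + bY + c = 0: it belongs to the opposite
vector (−Y, −1, 1, …, 1), which is close to all ones. Hence y solves the equation of `yOpt` with
perturbed coefficients. -/
theorem yChoice_eq (n : ℕ) :
    yChoice n = (-critB n + √(critB n ^ 2 - 4 * critA n * critC n)) / (2 * critA n) := by
  obtain ⟨h2, h1, h0⟩ := coeff_critPoly n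
  rw [yChoice, critDisc_eq, h2, h1, Real.sqrt_mul (by norm_num), show (4 : ℝ) = 2 ^ 2 by norm_num,
    Real.sqrt_sq (by norm_num), ← mul_div_mul_left _ (2 * critA n) (two_ne_zero)]
  congr 1
  ring

theorem two_pow_two_mul_add_one (m : ℕ) : (2 : ℝ) ^ (2 * m + 1) = 2 * 4 ^ m := by
  rw [pow_two_mul_add_one]; norm_num

theorem abs_flip_le (m : ℕ) : |pertJ (flip (2 * m))| ≤ 4 ∧ |pertQ (flip (2 * m))| ≤ 8 * 4 ^ m ∧
    |pertQQ (flip (2 * m))| ≤ 16 ∧ |pertR (flip (2 * m))| ≤ 16 * 16 ^ m ∧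
    |pertRR (flip (2 * m))| ≤ 32 * 4 ^ m := by
  have hw := weight_flip_le (2 * m)
  have hw0 := weight_nonneg (flip (2 * m))
  have h16 : (16 : ℝ) ^ m = 4 ^ m * 4 ^ m := by rw [← mul_pow]; norm_num
  have hw2 : weight (flip (2 * m)) ^ 2 ≤ 16 := by nlinarith
  refine ⟨(abs_pertJ_le _).trans hw, (abs_pertQ_le _).trans ?_, (abs_pertQQ_le _).trans hw2,
    (abs_pertR_le _).trans ?_, (abs_pertRR_le _).trans ?_⟩ <;>
  rw [two_pow_two_mul_add_one]
  · calc (2 : ℝ) * 4 ^ m * weight (flip (2 * m)) ≤ 2 * 4 ^ m * 4 := by gcongr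
      _ = _ := by ring
  · calc (2 : ℝ) * 4 ^ m * (2 * 4 ^ m) * weight (flip (2 * m)) ≤ 2 * 4 ^ m * (2 * 4 ^ m) * 4 := by
          gcongr
      _ = _ := by rw [h16]; ring
  · calc (2 : ℝ) * 4 ^ m * weight (flip (2 * m)) ^ 2 ≤ 2 * 4 ^ m * 16 := by gcongr
      _ = _ := by ring

theorem expLim_div_nat_of_le {u : ℕ → ℝ} {K r : ℝ} (hr : 0 < r) (hu : ∀ m, |u m| ≤ K * r ^ m) :
    ExpLim (fun m => u m / m) r 0 :=
  ((ExpLim.pow_self hr.ne').const_mul K).div_nat.squeeze hr (.of_forall fun m => by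
    rw [abs_div, Nat.abs_cast]; gcongr; exact hu m)

theorem expLim_zero_of_le {u : ℕ → ℝ} {K r s : ℝ} (hr : 0 < r) (hrs : r < s)
    (hu : ∀ m, |u m| ≤ K * r ^ m) : ExpLim u s 0 :=
  (((ExpLim.pow_self hr.ne').const_mul K).weaken hr hrs).squeeze (hr.trans hrs) (.of_forall hu)

theorem expLim_critA_sub : ExpLim (fun m => (critA (2 * m) - detA (2 * m)) / m) 5 0 := by
  have hQ : ExpLim (fun m => pertQ (flip (2 * m))) 5 0 :=
    expLim_zero_of_le (by norm_num) (by norm_num) fun m => (abs_flip_le m).2.1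
  have hJ : ExpLim (fun m => pertJ (flip (2 * m)) / m) 1 0 :=
    expLim_div_nat_of_le (K := 4) (by norm_num) fun m => by simpa using (abs_flip_le m).1
  refine ((hQ.const_mul (-2)).add ((expLim_e₁.mul hJ).weaken (by norm_num) (by norm_num))).cast
    rfl (by norm_num) ?_
  filter_upwards [eventually_ne_atTop 0] with m hm
  have : (m : ℝ) ≠ 0 := Nat.cast_ne_zero.2 hm
  rw [critA, detA]; push_cast; field_simp; ring

theorem expLim_critB_sub : ExpLim (fun m => (critB (2 * m) - detB (2 * m)) / m) 17 0 := by
  have hQ : ExpLim (fun m => pertQ (flip (2 * m)) / m) 4 0 :=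
    expLim_div_nat_of_le (by norm_num) fun m => (abs_flip_le m).2.1
  have hQQ : ExpLim (fun m => pertQQ (flip (2 * m)) / m) 4 0 :=
    (expLim_div_nat_of_le (r := 1) (K := 16) (by norm_num) fun m => by
      simpa using (abs_flip_le m).2.2.1).weaken (by norm_num) (by norm_num)
  have hR : ExpLim (fun m => pertR (flip (2 * m))) 17 0 :=
    expLim_zero_of_le (by norm_num) (by norm_num) fun m => (abs_flip_le m).2.2.2.1
  have hRR : ExpLim (fun m => pertRR (flip (2 * m))) 17 0 :=
    expLim_zero_of_le (by norm_num) (by norm_num) fun m => (abs_flip_le m).2.2.2.2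
  refine (((hR.const_mul (-4)).add (hRR.const_mul 2)).sub
    ((expLim_e₁.mul ((hQ.const_mul (-2)).add hQQ)).weaken (by norm_num) (by norm_num))).cast
    rfl (by norm_num) ?_
  filter_upwards [eventually_ne_atTop 0] with m hm
  have : (m : ℝ) ≠ 0 := Nat.cast_ne_zero.2 hm
  rw [critB, detB]; push_cast; field_simp; ring

/-- Both products in `detC` have order 256^m and cancel down to 144^m. A perturbation of bounded
weight changes the expression by only O(64^m), and the division by m turns this into o(64^m). -/
theorem expLim_critC_sub : ExpLim (fun m => (critC (2 * m) - detC (2 * m)) / m) 64 0 := by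
  have hJ : ExpLim (fun m => pertJ (flip (2 * m)) / m) 1 0 :=
    expLim_div_nat_of_le (K := 4) (by norm_num) fun m => by simpa using (abs_flip_le m).1
  have hQ : ExpLim (fun m => pertQ (flip (2 * m))) 5 0 :=
    expLim_zero_of_le (by norm_num) (by norm_num) fun m => (abs_flip_le m).2.1
  have hQ' : ExpLim (fun m => pertQ (flip (2 * m)) / m) 4 0 :=
    expLim_div_nat_of_le (by norm_num) fun m => (abs_flip_le m).2.1
  have hQQ : ExpLim (fun m => pertQQ (flip (2 * m)) / m) 4 0 :=
    (expLim_div_nat_of_le (r := 1) (K := 16) (by norm_num) fun m => by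
      simpa using (abs_flip_le m).2.2.1).weaken (by norm_num) (by norm_num)
  have hR : ExpLim (fun m => pertR (flip (2 * m))) 64 0 :=
    expLim_zero_of_le (by norm_num) (by norm_num) fun m => (abs_flip_le m).2.2.2.1
  have hRR : ExpLim (fun m => pertRR (flip (2 * m))) 64 0 :=
    expLim_zero_of_le (by norm_num) (by norm_num) fun m => (abs_flip_le m).2.2.2.2
  have hR' : ExpLim (fun m => pertR (flip (2 * m)) / m) 16 0 :=
    expLim_div_nat_of_le (by norm_num) fun m => (abs_flip_le m).2.2.2.1
  have hRR' : ExpLim (fun m => pertRR (flip (2 * m)) / m) 16 0 :=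
    (expLim_div_nat_of_le (by norm_num) fun m => (abs_flip_le m).2.2.2.2).weaken
      (by norm_num) (by norm_num)
  have t1 := (hJ.mul ((expLim_ell₃.add (hR.const_mul (-2))).add hRR)).cast (s := 64)
    (by norm_num) rfl (.of_forall fun _ => rfl)
  have t2 := (expLim_e₁.mul ((hR'.const_mul (-2)).add hRR')).cast (s := 64)
    (by norm_num) rfl (.of_forall fun _ => rfl)
  have t3 := (expLim_ell₂.mul ((hQ'.const_mul (-3)).add hQQ)).cast (s := 64)
    (by norm_num) rfl (.of_forall fun _ => rfl)
  have t4 := (hQ.mul ((hQ'.const_mul (-2)).add hQQ)).weaken (by norm_num)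
    (show _ < (64 : ℝ) by norm_num)
  refine (((t2.sub t1).sub t3).add t4).cast rfl (by norm_num) ?_
  filter_upwards [eventually_ne_atTop 0] with m hm
  have : (m : ℝ) ≠ 0 := Nat.cast_ne_zero.2 hm
  rw [critC, detC]; field_simp; ring

theorem expLim_critA : ExpLim (fun m => critA (2 * m) / m) 16 8 :=
  (expLim_detA.add (expLim_critA_sub.weaken (by norm_num) (by norm_num))).cast rfl (by norm_num)
    (.of_forall fun m => by ring)

theorem expLim_critB : ExpLim (fun m => critB (2 * m) / m) 64 16 :=
  (expLim_detB.add (expLim_critB_sub.weaken (by norm_num) (by norm_num))).cast rfl (by norm_num)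
    (.of_forall fun m => by ring)

theorem expLim_critC : ExpLim (fun m => critC (2 * m)) 144 12 :=
  (expLim_detC.add (expLim_critC_sub.nat_mul (by norm_num) (by norm_num))).cast rfl (by norm_num)
    ((eventually_mul_div_cancel _).mono fun m hm => by rw [hm]; ring)

theorem expLim_yChoice : ExpLim (fun m => m * yChoice (2 * m)) (9 / 4) (-3 / 4) :=
  (expLim_root expLim_critA expLim_critB expLim_critC).cast rfl rfl
    (.of_forall fun m => by rw [yChoice_eq])

theorem expLim_zero_of_nat_mul {u : ℕ → ℝ} {r l : ℝ} (h : ExpLim (fun m => m * u m) r l) :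
    ExpLim u r 0 :=
  h.div_nat.cast rfl rfl ((eventually_ne_atTop 0).mono fun m hm => by
    have : (m : ℝ) ≠ 0 := Nat.cast_ne_zero.2 hm
    field_simp)

/-- Subtracting the two quadratic equations gives (A(y + y₀) + B)(y − y₀) = −(ΔA·y² + ΔB·y + ΔC).
The first factor has order m·64^m, while the right-hand side is o(m·64^m). -/
theorem expLim_yChoice_sub : ExpLim (fun m => yChoice (2 * m) - yOpt (2 * m)) 1 0 := by
  have hy := expLim_zero_of_nat_mul expLim_yChoice
  have hy' := expLim_zero_of_nat_mul expLim_yOpt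
  have hG := ((expLim_detA.mul (hy.add hy')).weaken (by norm_num)
    (show _ < (64 : ℝ) by norm_num)).add expLim_detB
  have hN := ((((expLim_critA_sub.mul (hy.mul hy)).weaken (by norm_num)
    (show _ < (64 : ℝ) by norm_num)).add ((expLim_critB_sub.mul hy).weaken (by norm_num)
    (show _ < (64 : ℝ) by norm_num))).add expLim_critC_sub).neg
  refine (hN.div hG (by norm_num)).cast (by norm_num) (by norm_num) ?_
  filter_upwards [eventually_ne_atTop 0, eventually_detA_pos, eventually_uni_disc_nonneg,
    eventually_pos_of_div expLim_critA (by norm_num) (by norm_num),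
    eventually_disc_nonneg expLim_critA expLim_critB expLim_critC,
    hG.eventually_pos (by norm_num) (by norm_num)] with m hm hA hd hA' hd' hpos
  have hm' : (m : ℝ) ≠ 0 := Nat.cast_ne_zero.2 hm
  have h1 := yOpt_quadratic hA.ne' hd
  have h2 : critA (2 * m) * yChoice (2 * m) ^ 2 + critB (2 * m) * yChoice (2 * m) +
      critC (2 * m) = 0 := by
    have hs := Real.sq_sqrt hd'
    rw [yChoice_eq]
    set S := √(critB (2 * m) ^ 2 - 4 * critA (2 * m) * critC (2 * m))
    field_simp
    linear_combination hs
  rw [div_eq_iff hpos.ne']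
  field_simp
  linear_combination h1 - h2

end EulerianRelaxation
end

/-! ### Asymptotics of L(xᵢs) and L(xᵢs²). -/

open scoped Matrix
noncomputable section
namespace EulerianRelaxation
open Filter Topology

/-! ### Row sums of the `L`-form -/

section Rows

open MvPolynomial (X)

theorem sum_range_two_pow (n : ℕ) : ∑ k ∈ Finset.range n, (2 : ℝ) ^ (k + 1) = 2 ^ (n + 1) - 2 := by
  induction n with
  | zero => simp
  | succ n ih => rw [Finset.sum_range_succ, ih]; ring

theorem sum_range_ite_two_pow_le (n i : ℕ) :
    ∑ k ∈ Finset.range n, (if k ≤ i then (2 : ℝ) ^ (k + 1) else 0) ≤ 2 * 2 ^ (i + 1) := by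
  rw [← Finset.sum_filter]
  calc ∑ k ∈ Finset.range n with k ≤ i, (2 : ℝ) ^ (k + 1)
      ≤ ∑ k ∈ Finset.range (i + 1), (2 : ℝ) ^ (k + 1) := by
        refine Finset.sum_le_sum_of_subset_of_nonneg (fun k hk => ?_) fun _ _ _ => by positivity
        simp only [Finset.mem_filter, Finset.mem_range] at hk ⊢
        omega
    _ ≤ _ := by rw [sum_range_two_pow, pow_succ _ (i + 1)]; linarith

/-- Terms with k > i equal 2^(k+1)αᵢ exactly. Those with k ≤ i cost at most 4·4^(i+1) in total, and
completing the geometric sum costs another 2αᵢ, whence 6. -/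
theorem abs_rowQuad_sub_le {n : ℕ} (i : Fin n) :
    |rowQuad n i - 2 ^ (n + 1) * alpha i| ≤ 6 * 4 ^ ((i : ℕ) + 1) := by
  obtain ⟨i, hi⟩ := i
  have hrow : rowQuad n ⟨i, hi⟩ = ∑ k ∈ Finset.range n, quad (eulerSeq X n 0) k i := by
    rw [← Fin.sum_univ_eq_sum_range (fun k => quad (eulerSeq X n 0) k i)]
    exact Finset.sum_congr rfl fun k _ => quad_eulerian_eq _ _
  have hα := alpha_nonneg i
  have hα' := alpha_le i
  have h1 : (1 : ℝ) ≤ 2 ^ (i + 1) := one_le_pow₀ (by norm_num)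
  have h4 : (4 : ℝ) ^ (i + 1) = 2 ^ (i + 1) * 2 ^ (i + 1) := by rw [← mul_pow]; norm_num
  have hterm : ∀ k ∈ Finset.range n, |quad (eulerSeq X n 0) k i - 2 ^ (k + 1) * alpha i| ≤
      2 * 2 ^ (i + 1) * (if k ≤ i then (2 : ℝ) ^ (k + 1) else 0) := by
    intro k hk
    rw [Finset.mem_range] at hk
    split_ifs with h
    · have hq := abs_quad_eulerian_le hk hi
      have h2 : 2 ^ (k + 1) * alpha i ≤ 2 ^ (k + 1) * 2 ^ (i + 1) := by gcongr
      have h3 : 0 ≤ 2 ^ (k + 1) * alpha i := by positivity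
      rw [abs_le] at hq ⊢
      constructor <;> linarith
    · rw [quad_comm, quad_eulerian (by omega) hk]; simp
  have hsum : |∑ k ∈ Finset.range n, (quad (eulerSeq X n 0) k i - 2 ^ (k + 1) * alpha i)| ≤
      2 * 2 ^ (i + 1) * (2 * 2 ^ (i + 1)) := by
    refine (Finset.abs_sum_le_sum_abs _ _).trans ((Finset.sum_le_sum hterm).trans ?_)
    rw [← Finset.mul_sum]
    gcongr
    exact sum_range_ite_two_pow_le n i
  rw [Finset.sum_sub_distrib, ← Finset.sum_mul, sum_range_two_pow, ← hrow] at hsum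
  change |rowQuad n ⟨i, hi⟩ - 2 ^ (n + 1) * alpha i| ≤ 6 * 4 ^ (i + 1)
  rw [abs_le] at hsum ⊢
  constructor <;> nlinarith

/-- The subdominant pair weight in `cubic`. -/
def theta (j k : ℕ) : ℝ :=
  if j < k then (3 / 2) ^ (j + 1) * 2 ^ (k + 1)
  else if k < j then (3 / 2) ^ (k + 1) * 2 ^ (j + 1) else 0

theorem theta_comm (j k : ℕ) : theta j k = theta k j := by
  rcases lt_trichotomy j k with h | rfl | h
  · rw [theta, theta, if_pos h, if_neg h.not_gt, if_pos h]
  · rfl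
  · rw [theta, theta, if_neg h.not_gt, if_pos h, if_pos h]

theorem theta_nonneg (j k : ℕ) : 0 ≤ theta j k := by
  rw [theta]; split_ifs <;> positivity

theorem theta_le (j k : ℕ) : theta j k ≤ 2 ^ (j + 1) * 2 ^ (k + 1) := by
  have h : ∀ i : ℕ, (3 / 2 : ℝ) ^ (i + 1) ≤ 2 ^ (i + 1) := fun i =>
    pow_le_pow_left₀ (by norm_num) (by norm_num) _
  rw [theta]; split_ifs
  · gcongr; norm_num
  · rw [mul_comm (2 ^ (j + 1))]; gcongr; norm_num
  · positivity

theorem sum_range_theta_right (n : ℕ) :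
    ∑ j ∈ Finset.range n, theta j n = 2 ^ (n + 1) * (3 * (3 / 2) ^ n - 3) := by
  have h1 : ∀ j ∈ Finset.range n, theta j n = (3 / 2) ^ (j + 1) * 2 ^ (n + 1) := fun j hj => by
    rw [theta, if_pos (Finset.mem_range.1 hj)]
  have h2 : ∀ r : ℕ, ∑ j ∈ Finset.range r, (3 / 2 : ℝ) ^ (j + 1) = 3 * (3 / 2) ^ r - 3 := by
    intro r
    induction r with
    | zero => simp
    | succ r ih => rw [Finset.sum_range_succ, ih]; ring
  rw [Finset.sum_congr rfl h1, ← Finset.sum_mul, h2, mul_comm]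

/-- The source of the correction 3^(n+1)βᵢ in L(xᵢs²): half of this double sum has leading term
3^(n+1). -/
theorem sum_range_theta (n : ℕ) : ∑ j ∈ Finset.range n, ∑ k ∈ Finset.range n, theta j k =
    2 * (3 ^ (n + 1) - 3 * 2 ^ (n + 1) + 3) := by
  induction n with
  | zero => norm_num
  | succ n ih =>
    rw [Finset.sum_range_succ]
    simp only [Finset.sum_range_succ _ n, Finset.sum_add_distrib]
    rw [ih, sum_range_theta_right]
    have h : ∑ k ∈ Finset.range n, theta n k = ∑ k ∈ Finset.range n, theta k n :=
      Finset.sum_congr rfl fun k _ => theta_comm n k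
    have h0 : theta n n = 0 := by simp [theta]
    have h3 : (2 : ℝ) ^ n * (3 / 2) ^ n = 3 ^ n := by rw [← mul_pow]; norm_num
    rw [h, sum_range_theta_right, h0]
    linear_combination 12 * h3

/-- The approximant is exact when i is smaller than two distinct indices j and k. The three error
terms account for j ≤ i, k ≤ i and j = k. -/
theorem abs_cubic_sub_le {n i j k : ℕ} (hi : i < n) (hj : j < n) (hk : k < n) :
    |cubic (eulerSeq X n 0) i j k -
        (2 ^ (j + 1) * 2 ^ (k + 1) * alpha i - theta j k * beta i / 2)| ≤
      2 * 2 ^ (i + 1) * ((if j ≤ i then (2 : ℝ) ^ (j + 1) else 0) * 2 ^ (k + 1) +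
        2 ^ (j + 1) * (if k ≤ i then (2 : ℝ) ^ (k + 1) else 0) +
        (if j = k then (2 : ℝ) ^ (j + 1) else 0)) := by
  have hα := alpha_nonneg i
  have hα' := alpha_le i
  have hβ := beta_nonneg i
  have hβ' := beta_le i
  by_cases hji : j ≤ i ∨ k ≤ i
  · have h1 : |cubic (eulerSeq X n 0) i j k -
        (2 ^ (j + 1) * 2 ^ (k + 1) * alpha i - theta j k * beta i / 2)| ≤
        2 * 2 ^ (i + 1) * (2 ^ (j + 1) * 2 ^ (k + 1)) := by
      have hc := abs_cubic_eulerian_le hi hj hk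
      have hθ := theta_nonneg j k
      have ha : |2 ^ (j + 1) * 2 ^ (k + 1) * alpha i - theta j k * beta i / 2| ≤
          2 ^ (j + 1) * 2 ^ (k + 1) * 2 ^ (i + 1) := by
        apply abs_sub_half_le (by positivity) (by gcongr) (by positivity)
        gcongr
        exact theta_le j k
      rw [abs_le] at hc ha ⊢
      constructor <;> linarith
    refine h1.trans ?_
    gcongr
    rcases hji with h | h
    · rw [if_pos h, add_assoc]
      exact le_add_of_nonneg_right (by split_ifs <;> positivity)
    · rw [if_pos h, add_right_comm]
      exact le_add_of_nonneg_left (by split_ifs <;> positivity)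
  · push Not at hji
    obtain ⟨hij, hik⟩ := hji
    rw [if_neg hij.not_ge, if_neg hik.not_ge, zero_mul, mul_zero, zero_add, zero_add]
    rcases lt_trichotomy j k with h | rfl | h
    · rw [cubic_eulerian hij h hk, theta, if_pos h, if_neg h.ne]; simp
    · rw [cubic_eulerian_self_right hij hj, if_pos rfl]
      have : theta j j = 0 := by simp [theta]
      rw [this, show (2 ^ (j + 1) - 1) * (2 ^ (j + 1) * alpha i) -
        (2 ^ (j + 1) * 2 ^ (j + 1) * alpha i - 0 * beta i / 2) = -(alpha i * 2 ^ (j + 1)) by ring,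
        abs_neg, abs_of_nonneg (by positivity)]
      gcongr
      linarith
    · rw [cubic_swap_right, cubic_eulerian hik h hj, theta, if_neg h.not_gt, if_pos h, if_neg h.ne']
      rw [mul_comm (2 ^ (k + 1))]; simp

/-- With N = 2^(n+1) and I = 2^(i+1), the exceptional index pairs cost (8 + 2)·N·I² and the
lower-order terms of the two closed sums cost 4N·αᵢ and 3N·βᵢ, whence 17. -/
theorem abs_sum_rowCubic_sub_le {n : ℕ} (i : Fin n) :
    |∑ j, rowCubic n i j - (2 ^ (n + 1) * 2 ^ (n + 1) * alpha i - 3 ^ (n + 1) * beta i)| ≤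
      17 * 2 ^ (n + 1) * 4 ^ ((i : ℕ) + 1) := by
  obtain ⟨i, hi⟩ := i
  have hrow : ∑ j, rowCubic n ⟨i, hi⟩ j =
      ∑ j ∈ Finset.range n, ∑ k ∈ Finset.range n, cubic (eulerSeq X n 0) i j k := by
    rw [← Fin.sum_univ_eq_sum_range
      (fun j => ∑ k ∈ Finset.range n, cubic (eulerSeq X n 0) i j k)]
    refine Finset.sum_congr rfl fun j _ => ?_
    rw [← Fin.sum_univ_eq_sum_range (fun k => cubic (eulerSeq X n 0) i j k)]
    refine Finset.sum_congr rfl fun k _ => ?_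
    rw [cubic_eulerian_eq, cubic_swap_left, cubic_swap_right]
  have hα := alpha_nonneg i
  have hα' := alpha_le i
  have hβ := beta_nonneg i
  have hβ' := beta_le i
  have h1 : (1 : ℝ) ≤ 2 ^ (i + 1) := one_le_pow₀ (by norm_num)
  have hn2 : (2 : ℝ) ≤ 2 ^ (n + 1) := by
    rw [pow_succ]; have : (1 : ℝ) ≤ 2 ^ n := one_le_pow₀ (by norm_num)
    linarith
  have h4 : (4 : ℝ) ^ (i + 1) = 2 ^ (i + 1) * 2 ^ (i + 1) := by rw [← mul_pow]; norm_num
  have hN : ∑ k ∈ Finset.range n, (2 : ℝ) ^ (k + 1) ≤ 2 ^ (n + 1) := by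
    rw [sum_range_two_pow]; linarith
  have hsum : |∑ j ∈ Finset.range n, ∑ k ∈ Finset.range n, (cubic (eulerSeq X n 0) i j k -
        (2 ^ (j + 1) * 2 ^ (k + 1) * alpha i - theta j k * beta i / 2))| ≤
      2 * 2 ^ (i + 1) * (2 * 2 ^ (i + 1) * 2 ^ (n + 1) + 2 ^ (n + 1) * (2 * 2 ^ (i + 1)) +
        2 ^ (n + 1)) := by
    calc _ ≤ ∑ j ∈ Finset.range n, ∑ k ∈ Finset.range n,
          2 * 2 ^ (i + 1) * ((if j ≤ i then (2 : ℝ) ^ (j + 1) else 0) * 2 ^ (k + 1) +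
            2 ^ (j + 1) * (if k ≤ i then (2 : ℝ) ^ (k + 1) else 0) +
            (if j = k then (2 : ℝ) ^ (j + 1) else 0)) := by
          refine (Finset.abs_sum_le_sum_abs _ _).trans (Finset.sum_le_sum fun j hj => ?_)
          refine (Finset.abs_sum_le_sum_abs _ _).trans (Finset.sum_le_sum fun k hk => ?_)
          exact abs_cubic_sub_le hi (Finset.mem_range.1 hj) (Finset.mem_range.1 hk)
      _ ≤ _ := by
          simp only [← Finset.mul_sum, Finset.sum_add_distrib, ← Finset.sum_mul]
          have hdiag : ∑ j ∈ Finset.range n, ∑ k ∈ Finset.range n,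
              (if j = k then (2 : ℝ) ^ (j + 1) else 0) = ∑ j ∈ Finset.range n, (2 : ℝ) ^ (j + 1) :=
            Finset.sum_congr rfl fun j hj => by rw [Finset.sum_ite_eq, if_pos hj]
          rw [hdiag]
          have hI := sum_range_ite_two_pow_le n i
          have hI0 : 0 ≤ ∑ k ∈ Finset.range n, (if k ≤ i then (2 : ℝ) ^ (k + 1) else 0) :=
            Finset.sum_nonneg fun k _ => by split_ifs <;> positivity
          gcongr
  have hap : ∑ j ∈ Finset.range n, ∑ k ∈ Finset.range n,
      (2 ^ (j + 1) * 2 ^ (k + 1) * alpha i - theta j k * beta i / 2) =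
      (2 ^ (n + 1) - 2) * (2 ^ (n + 1) - 2) * alpha i -
        (3 ^ (n + 1) - 3 * 2 ^ (n + 1) + 3) * beta i := by
    simp only [Finset.sum_sub_distrib, ← Finset.sum_div, ← Finset.sum_mul, ← Finset.mul_sum,
      sum_range_theta, sum_range_two_pow]
    ring
  simp only [Finset.sum_sub_distrib] at hsum hap
  rw [hap, ← hrow] at hsum
  change |∑ j, rowCubic n ⟨i, hi⟩ j -
    (2 ^ (n + 1) * 2 ^ (n + 1) * alpha i - 3 ^ (n + 1) * beta i)| ≤
      17 * 2 ^ (n + 1) * 4 ^ (i + 1)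
  rw [h4]
  set N : ℝ := 2 ^ (n + 1)
  set I : ℝ := 2 ^ (i + 1)
  have p1 : N * alpha i ≤ N * I := by gcongr
  have p2 : N * beta i ≤ N * I := by gcongr
  have p3 : N * I ≤ N * (I * I) := by gcongr; nlinarith
  have p4 : 0 ≤ N * alpha i := by positivity
  have p5 : 0 ≤ N * beta i := by positivity
  have p6 : 2 * alpha i ≤ N * alpha i := by gcongr
  have p7 : 2 * beta i ≤ N * beta i := by gcongr
  rw [abs_le] at hsum ⊢
  constructor <;> nlinarith

end Rows

end EulerianRelaxation
end

/-! ### The dominant term of N(v) − λD(v). -/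

open scoped Matrix
noncomputable section
namespace EulerianRelaxation
open Filter Topology

/-! ### The multivariate bound -/

/-- The deviation of the entries of `newVec m` from `1`, with indices starting at `0`. -/
def dev (m i : ℕ) : ℝ :=
  if i + 3 ≤ m then 1 + 2 ^ (m - (i + 3)) else if i + 2 = m then 1
  else if i + 1 = m then 1 / 2 else 0

/-- The deviation of `newVec m` from the all-ones vector. -/
def devVec (m : ℕ) : Fin (2 * m) → ℝ := fun i => dev m i

theorem newVec_eq (m : ℕ) : newVec m = Fin.cons (yChoice (2 * m)) fun i =>
    algebraMap ℝ ℝ (1 * (1 - devVec m i)) := by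
  ext1 k
  refine Fin.cases ?_ (fun i => ?_) k
  · simp [newVec]
  · rw [Fin.cons_succ, devVec, newVec, dev]
    simp only [Fin.val_succ, Nat.succ_ne_zero, if_false, add_assoc, Nat.reduceAdd,
      Algebra.algebraMap_self, RingHom.id_apply]
    split_ifs <;> ring

theorem dev_nonneg (m i : ℕ) : 0 ≤ dev m i := by
  rw [dev]; split_ifs <;> positivity

theorem dev_of_le {m i : ℕ} (h : m ≤ i) : dev m i = 0 := by
  rw [dev, if_neg (by omega), if_neg (by omega), if_neg (by omega)]

/-- The powers of 2 in v are exactly geometric in the index, apart from the added 1 and the two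
exceptional entries near m. -/
theorem dev_near {m i : ℕ} (h : i < m) :
    |dev m i - 2 ^ m / 4 * (1 / 2) ^ (i + 1)| ≤ 1 ∧ dev m i ≤ 2 ^ m * (1 / 2) ^ (i + 1) := by
  obtain ⟨r, rfl⟩ := Nat.exists_eq_add_of_lt h
  have hp : (2 : ℝ) ^ (i + r + 1) * (1 / 2) ^ (i + 1) = 2 ^ r := by
    rw [show i + r + 1 = i + 1 + r by ring, pow_add, mul_right_comm, ← mul_pow]; norm_num
  rw [div_mul_eq_mul_div, hp]
  rcases r with _ | _ | r
  · rw [dev, if_neg (by omega), if_neg (by omega), if_pos (by omega)]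
    constructor
    · rw [abs_le]; norm_num
    · norm_num
  · rw [dev, if_neg (by omega), if_pos (by omega)]
    constructor
    · rw [abs_le]; norm_num
    · norm_num
  · rw [dev, if_pos (by omega), show i + (r + 1 + 1) + 1 - (i + 3) = r by omega]
    have : (1 : ℝ) ≤ 2 ^ r := one_le_pow₀ (by norm_num)
    rw [show (2 : ℝ) ^ (r + 1 + 1) = 4 * 2 ^ r by ring]
    constructor
    · rw [abs_le]; constructor <;> linarith
    · linarith

theorem sum_dev_eq (m : ℕ) (f : ℕ → ℝ) :
    ∑ i : Fin (2 * m), f i * devVec m i = ∑ i ∈ Finset.range m, f i * dev m i := by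
  simp only [devVec]
  rw [Fin.sum_univ_eq_sum_range (fun i => f i * dev m i)]
  refine (Finset.sum_subset (fun i hi => ?_) fun i _ hi => ?_).symm
  · simp only [Finset.mem_range] at hi ⊢; omega
  · rw [dev_of_le (by simpa using hi), mul_zero]

theorem abs_sum_dev_le (m : ℕ) (f : Fin (2 * m) → ℝ) (g : ℕ → ℝ)
    (hfg : ∀ i : Fin (2 * m), |f i| ≤ g i) :
    |∑ i, f i * devVec m i| ≤ 2 ^ m * ∑ i ∈ Finset.range m, g i * (1 / 2) ^ (i + 1) := by
  calc |∑ i, f i * devVec m i| ≤ ∑ i : Fin (2 * m), g i * devVec m i := by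
        refine (Finset.abs_sum_le_sum_abs _ _).trans (Finset.sum_le_sum fun i _ => ?_)
        rw [abs_mul, devVec, abs_of_nonneg (dev_nonneg _ _)]
        exact mul_le_mul_of_nonneg_right (hfg i) (dev_nonneg _ _)
    _ = ∑ i ∈ Finset.range m, g i * dev m i := sum_dev_eq m g
    _ ≤ _ := by
        rw [Finset.mul_sum]
        refine Finset.sum_le_sum fun i hi => ?_
        have him := Finset.mem_range.1 hi
        have hg : 0 ≤ g i := (abs_nonneg _).trans (hfg ⟨i, by omega⟩)
        calc g i * dev m i ≤ g i * (2 ^ m * (1 / 2) ^ (i + 1)) := by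
              gcongr; exact (dev_near him).2
          _ = _ := by ring

/-- Each of the m nonzero deviations contributes at most 2^m, since its decay cancels the growth
2^(i+1). -/
theorem weight_devVec_le (m : ℕ) : weight (devVec m) ≤ m * 2 ^ m := by
  have h : weight (devVec m) = ∑ i ∈ Finset.range m, 2 ^ (i + 1) * dev m i := by
    rw [← sum_dev_eq m (fun i => 2 ^ (i + 1)), weight]
    refine Finset.sum_congr rfl fun i _ => ?_
    rw [devVec, abs_of_nonneg (dev_nonneg _ _), mul_comm]
  rw [h]
  calc ∑ i ∈ Finset.range m, 2 ^ (i + 1) * dev m i ≤ ∑ i ∈ Finset.range m, (2 : ℝ) ^ m := by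
        refine Finset.sum_le_sum fun i hi => ?_
        calc (2 : ℝ) ^ (i + 1) * dev m i ≤ 2 ^ (i + 1) * (2 ^ m * (1 / 2) ^ (i + 1)) := by
              gcongr; exact (dev_near (Finset.mem_range.1 hi)).2
          _ = 2 ^ m := by
              rw [mul_left_comm, ← mul_pow]; norm_num
    _ = _ := by simp

theorem expLim_weight {s : ℝ} (hs : 2 < s) : ExpLim (fun m => weight (devVec m)) s 0 :=
  ((ExpLim.pow_self two_ne_zero).nat_mul two_pos hs).squeeze (by linarith)
    (.of_forall fun m => by
      rw [abs_of_nonneg (weight_nonneg _)]; exact weight_devVec_le m)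

theorem expLim_pertJ : ExpLim (fun m => pertJ (devVec m)) 3 0 :=
  (expLim_weight (by norm_num)).squeeze (by norm_num) (.of_forall fun _ => abs_pertJ_le _)

/-- The rate 9 is chosen to pair with the o(2^m) error of λ: 2·9 = 18. -/
theorem expLim_pertQ : ExpLim (fun m => pertQ (devVec m)) 9 0 :=
  ((((ExpLim.pow_self four_ne_zero).const_mul 2).mul
    (expLim_weight (show (2 : ℝ) < 9 / 4 by norm_num))).cast (by norm_num) (by norm_num)
    (.of_forall fun m => by rw [← two_pow_two_mul_add_one])).squeeze (by norm_num)
    (.of_forall fun _ => abs_pertQ_le _)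

theorem expLim_weight_sq : ExpLim (fun m => weight (devVec m) ^ 2) (9 / 2) 0 := by
  -- Any rate above 2 with square below 9/2 works. The target 9/2 is chosen because 4·(9/2) = 18
  -- disposes of both λQQ and RR.
  have h := expLim_weight (show (2 : ℝ) < 33 / 16 by norm_num)
  exact ((h.mul h).weaken (by norm_num) (by norm_num)).cast rfl rfl (.of_forall fun m => by ring)

theorem expLim_pertQQ : ExpLim (fun m => pertQQ (devVec m)) (9 / 2) 0 :=
  expLim_weight_sq.squeeze (by norm_num) (.of_forall fun _ => abs_pertQQ_le _)

theorem expLim_pertRR : ExpLim (fun m => pertRR (devVec m)) 18 0 :=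
  ((((ExpLim.pow_self four_ne_zero).const_mul 2).mul expLim_weight_sq).cast (by norm_num)
    (by norm_num) (.of_forall fun m => by rw [← two_pow_two_mul_add_one])).squeeze (by norm_num)
    (.of_forall fun _ => abs_pertRR_le _)

theorem sum_range_pow_succ {q : ℝ} (hq : q ≠ 1) (m : ℕ) :
    ∑ i ∈ Finset.range m, q ^ (i + 1) = q / (1 - q) * (1 - q ^ m) := by
  have : 1 - q ≠ 0 := sub_ne_zero.2 hq.symm
  induction m with
  | zero => simp
  | succ m ih => rw [Finset.sum_range_succ, ih]; field_simp; ring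

/-- The parts 2·4^m·2^(i+1) of 2·4^m L(xᵢ) and L(xᵢs) cancel, leaving order 4^m(3/2)^(i+1) and an
error 6·4^(i+1). Against the weights 2^(m−i−1) these sum to at most (6 + 12)·8^m. -/
theorem abs_two_mul_pertJ_sub_pertQ_le (m : ℕ) :
    |2 * 4 ^ m * pertJ (devVec m) - pertQ (devVec m)| ≤ 18 * 8 ^ m := by
  have h1 : 2 * 4 ^ m * pertJ (devVec m) - pertQ (devVec m) = ∑ i : Fin (2 * m),
      (2 * 4 ^ m * jet₁ (eulerian (2 * m)) i - rowQuad (2 * m) i) * devVec m i := by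
    rw [pertJ, pertQ, Finset.mul_sum, ← Finset.sum_sub_distrib]
    exact Finset.sum_congr rfl fun i _ => by ring
  have h2 : ∀ i : Fin (2 * m), |2 * 4 ^ m * jet₁ (eulerian (2 * m)) i - rowQuad (2 * m) i| ≤
      (fun i : ℕ => 2 * 4 ^ m * (3 / 2 : ℝ) ^ (i + 1) + 6 * 4 ^ (i + 1)) i := by
    intro i
    have hQ := abs_rowQuad_sub_le i
    rw [two_pow_two_mul_add_one] at hQ
    rw [jet₁_eulerian_eq, jet₁_eulerian i.2]
    have h32 : (1 : ℝ) ≤ (3 / 2) ^ ((i : ℕ) + 1) := one_le_pow₀ (by norm_num)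
    have h4 : (0 : ℝ) < 4 ^ m := by positivity
    rw [alpha] at hQ
    rw [abs_le] at hQ ⊢
    constructor <;> nlinarith
  rw [h1]
  refine (abs_sum_dev_le m _
    (fun i : ℕ => 2 * 4 ^ m * (3 / 2 : ℝ) ^ (i + 1) + 6 * 4 ^ (i + 1)) h2).trans ?_
  have h3 : ∀ i ∈ Finset.range m,
      (2 * 4 ^ m * (3 / 2 : ℝ) ^ (i + 1) + 6 * 4 ^ (i + 1)) * (1 / 2) ^ (i + 1) =
      2 * 4 ^ m * (3 / 4) ^ (i + 1) + 6 * 2 ^ (i + 1) := fun i _ => by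
    have e1 : (3 / 4 : ℝ) ^ (i + 1) = (3 / 2) ^ (i + 1) * (1 / 2) ^ (i + 1) := by
      rw [← mul_pow]; norm_num
    have e2 : (2 : ℝ) ^ (i + 1) = 4 ^ (i + 1) * (1 / 2) ^ (i + 1) := by
      rw [← mul_pow]; norm_num
    linear_combination -(2 * 4 ^ m) * e1 - 6 * e2
  rw [Finset.sum_congr rfl h3, Finset.sum_add_distrib, ← Finset.mul_sum, ← Finset.mul_sum,
    sum_range_pow_succ (by norm_num), sum_range_two_pow]
  have h8 : (8 : ℝ) ^ m = 2 ^ m * 4 ^ m := by rw [← mul_pow]; norm_num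
  have h24 : (2 : ℝ) ^ m ≤ 4 ^ m := pow_le_pow_left₀ (by norm_num) (by norm_num) _
  have h34 : (0 : ℝ) ≤ (3 / 4) ^ m := by positivity
  rw [h8, show (18 : ℝ) * (2 ^ m * 4 ^ m) = 2 ^ m * (18 * 4 ^ m) by ring]
  gcongr
  have h40 : (0 : ℝ) ≤ 4 ^ m * (3 / 4) ^ m := by positivity
  rw [pow_succ]
  nlinarith

theorem expLim_lam_mul_pertJ_sub :
    ExpLim (fun m => (lam (2 * m) * pertJ (devVec m) - pertQ (devVec m)) / m) 8 0 := by
  have h1 : ExpLim (fun m => lam (2 * m) - 2 * 4 ^ m) (9 / 4) (-(3 / 2)) :=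
    ((expLim_lam_expansion.weaken (by norm_num) (show _ < (9 / 4 : ℝ) by norm_num)).sub
      ((ExpLim.pow_self (show (9 / 4 : ℝ) ≠ 0 by norm_num)).const_mul (3 / 2))).cast rfl
      (by norm_num) (.of_forall fun m => by ring)
  have h2 := ((h1.mul expLim_pertJ).weaken (by norm_num) (show _ < (8 : ℝ) by norm_num)).div_nat
  have h3 := expLim_div_nat_of_le (by norm_num) abs_two_mul_pertJ_sub_pertQ_le
  exact (h2.add h3).cast rfl (by norm_num) (.of_forall fun m => by ring)

/-- The sum producing the dominant term of the difference of the two bounds. -/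
def mainSum (m : ℕ) : ℝ :=
  ∑ i ∈ Finset.range m, ((3 / 2) ^ (i + 1) - (4 / 3) ^ (i + 1)) * dev m i

/-- Replacing the deviations by (2^m/4)·2^(−i−1) costs at most m(3/2)^m, and the series of
(3/4)^(i+1) − (2/3)^(i+1) sums to 3 − 2 = 1. -/
theorem expLim_mainSum : ExpLim mainSum 2 (1 / 4) := by
  have hmain : ExpLim (fun m => 2 ^ m / 4 * ∑ i ∈ Finset.range m,
      ((3 / 4 : ℝ) ^ (i + 1) - (2 / 3) ^ (i + 1))) 2 (1 / 4) := by
    have ha := (ExpLim.pow_self (show (3 / 4 : ℝ) ≠ 0 by norm_num)).weaken (by norm_num)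
      (show _ < (1 : ℝ) by norm_num)
    have hb := (ExpLim.pow_self (show (2 / 3 : ℝ) ≠ 0 by norm_num)).weaken (by norm_num)
      (show _ < (1 : ℝ) by norm_num)
    refine (((ExpLim.pow_self (show (2 : ℝ) ≠ 0 by norm_num)).const_mul (1 / 4)).mul
      (((ExpLim.const 1).sub (ha.const_mul 3)).add (hb.const_mul 2))).cast (by norm_num)
      (by norm_num) (.of_forall fun m => ?_)
    rw [Finset.sum_sub_distrib, sum_range_pow_succ (by norm_num), sum_range_pow_succ (by norm_num)]
    ring
  have herr : ExpLim (fun m => mainSum m - 2 ^ m / 4 * ∑ i ∈ Finset.range m,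
      ((3 / 4 : ℝ) ^ (i + 1) - (2 / 3) ^ (i + 1))) 2 0 := by
    refine ((ExpLim.pow_self (show (3 / 2 : ℝ) ≠ 0 by norm_num)).nat_mul (by norm_num)
      (show _ < (2 : ℝ) by norm_num)).squeeze (by norm_num) (.of_forall fun m => ?_)
    have : mainSum m - 2 ^ m / 4 * ∑ i ∈ Finset.range m,
        ((3 / 4 : ℝ) ^ (i + 1) - (2 / 3) ^ (i + 1)) = ∑ i ∈ Finset.range m,
        ((3 / 2) ^ (i + 1) - (4 / 3) ^ (i + 1)) * (dev m i - 2 ^ m / 4 * (1 / 2) ^ (i + 1)) := by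
      rw [mainSum, Finset.mul_sum, ← Finset.sum_sub_distrib]
      refine Finset.sum_congr rfl fun i _ => ?_
      have e1 : (3 / 4 : ℝ) ^ (i + 1) = (3 / 2) ^ (i + 1) * (1 / 2) ^ (i + 1) := by
        rw [← mul_pow]; norm_num
      have e2 : (2 / 3 : ℝ) ^ (i + 1) = (4 / 3) ^ (i + 1) * (1 / 2) ^ (i + 1) := by
        rw [← mul_pow]; norm_num
      rw [e1, e2]; ring
    rw [this]
    calc _ ≤ ∑ i ∈ Finset.range m, (3 / 2 : ℝ) ^ m := by
          refine (Finset.abs_sum_le_sum_abs _ _).trans (Finset.sum_le_sum fun i hi => ?_)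
          have him := Finset.mem_range.1 hi
          have h1 : (4 / 3 : ℝ) ^ (i + 1) ≤ (3 / 2) ^ (i + 1) :=
            pow_le_pow_left₀ (by norm_num) (by norm_num) _
          have h2 : (0 : ℝ) ≤ (4 / 3) ^ (i + 1) := by positivity
          have h3 : (3 / 2 : ℝ) ^ (i + 1) ≤ (3 / 2) ^ m := pow_le_pow_right₀ (by norm_num) him
          rw [abs_mul, abs_of_nonneg (by linarith)]
          calc _ ≤ ((3 / 2 : ℝ) ^ (i + 1) - (4 / 3) ^ (i + 1)) * 1 :=
                mul_le_mul_of_nonneg_left (dev_near him).1 (by linarith)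
            _ ≤ _ := by linarith
      _ = m * (3 / 2) ^ m := by simp
  exact (hmain.add herr).cast rfl (by norm_num) (.of_forall fun m => by ring)

/-- Index by index, the 16^m terms of the row sums cancel and 3·9^m(βᵢ − αᵢ) remains. The row errors
combine to 2·6 + 17·2 = 46, and summing against the deviations doubles this. -/
theorem abs_pertQ_sub_pertR_sub_le (m : ℕ) :
    |(2 * 4 ^ m - 3 / 2 * (9 / 4) ^ m) * pertQ (devVec m) - pertR (devVec m) -
      3 * 9 ^ m * mainSum m| ≤ 92 * 16 ^ m := by
  have e94 : (9 / 4 : ℝ) ^ m * 4 ^ m = 9 ^ m := by rw [← mul_pow]; norm_num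
  have e3 : (3 : ℝ) ^ (2 * m + 1) = 3 * 9 ^ m := by rw [pow_two_mul_add_one]; norm_num
  have h1 : (2 * 4 ^ m - 3 / 2 * (9 / 4) ^ m) * pertQ (devVec m) - pertR (devVec m) -
      3 * 9 ^ m * mainSum m = ∑ i : Fin (2 * m),
      ((2 * 4 ^ m - 3 / 2 * (9 / 4) ^ m) * rowQuad (2 * m) i - ∑ j, rowCubic (2 * m) i j -
        3 * 9 ^ m * ((3 / 2) ^ ((i : ℕ) + 1) - (4 / 3) ^ ((i : ℕ) + 1))) * devVec m i := by
    rw [pertQ, pertR, mainSum, ← sum_dev_eq m (fun i => (3 / 2) ^ (i + 1) - (4 / 3) ^ (i + 1)),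
      Finset.mul_sum, Finset.mul_sum, ← Finset.sum_sub_distrib, ← Finset.sum_sub_distrib]
    exact Finset.sum_congr rfl fun i _ => by ring
  have h2 : ∀ i : Fin (2 * m),
      |(2 * 4 ^ m - 3 / 2 * (9 / 4) ^ m) * rowQuad (2 * m) i - ∑ j, rowCubic (2 * m) i j -
        3 * 9 ^ m * ((3 / 2) ^ ((i : ℕ) + 1) - (4 / 3) ^ ((i : ℕ) + 1))| ≤
      (fun i : ℕ => 46 * 4 ^ m * (4 : ℝ) ^ (i + 1)) i := by
    intro i
    have hQ := abs_rowQuad_sub_le i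
    have hR := abs_sum_rowCubic_sub_le i
    rw [two_pow_two_mul_add_one] at hQ hR
    rw [e3] at hR
    have hκ : |2 * 4 ^ m - 3 / 2 * (9 / 4 : ℝ) ^ m| ≤ 2 * 4 ^ m := by
      have : (9 / 4 : ℝ) ^ m ≤ 4 ^ m := pow_le_pow_left₀ (by norm_num) (by norm_num) _
      have h0 : (0 : ℝ) ≤ (9 / 4 : ℝ) ^ m := by positivity
      rw [abs_le]; constructor <;> linarith
    have hsplit : (2 * 4 ^ m - 3 / 2 * (9 / 4) ^ m) * rowQuad (2 * m) i -
        ∑ j, rowCubic (2 * m) i j -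
        3 * 9 ^ m * ((3 / 2) ^ ((i : ℕ) + 1) - (4 / 3) ^ ((i : ℕ) + 1)) =
        (2 * 4 ^ m - 3 / 2 * (9 / 4) ^ m) * (rowQuad (2 * m) i - 2 * 4 ^ m * alpha i) -
        (∑ j, rowCubic (2 * m) i j -
          (2 * 4 ^ m * (2 * 4 ^ m) * alpha i - 3 * 9 ^ m * beta i)) := by
      rw [alpha, beta]
      linear_combination (-3) * (2 ^ ((i : ℕ) + 1) - (3 / 2) ^ ((i : ℕ) + 1)) * e94
    change _ ≤ 46 * 4 ^ m * (4 : ℝ) ^ ((i : ℕ) + 1)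
    rw [hsplit]
    refine (abs_sub _ _).trans ?_
    rw [abs_mul]
    refine (add_le_add (mul_le_mul hκ hQ (abs_nonneg _) (by positivity)) hR).trans_eq ?_
    ring
  rw [h1]
  refine (abs_sum_dev_le m _ (fun i : ℕ => 46 * 4 ^ m * (4 : ℝ) ^ (i + 1)) h2).trans ?_
  have h3 : ∀ i ∈ Finset.range m, 46 * 4 ^ m * (4 : ℝ) ^ (i + 1) * (1 / 2) ^ (i + 1) =
      46 * 4 ^ m * 2 ^ (i + 1) := fun i _ => by
    rw [mul_assoc, ← mul_pow]; norm_num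
  rw [Finset.sum_congr rfl h3, ← Finset.mul_sum, sum_range_two_pow]
  have h16 : (16 : ℝ) ^ m = 2 ^ m * (4 ^ m * 2 ^ m) := by rw [← mul_pow, ← mul_pow]; norm_num
  rw [h16, show (92 : ℝ) * (2 ^ m * (4 ^ m * 2 ^ m)) = 2 ^ m * (92 * (4 ^ m * 2 ^ m)) by ring]
  refine mul_le_mul_of_nonneg_left ?_ (by positivity)
  have : (0 : ℝ) < 4 ^ m := by positivity
  rw [pow_succ]
  nlinarith

theorem expLim_lam_mul_pertQ_sub :
    ExpLim (fun m => lam (2 * m) * pertQ (devVec m) - pertR (devVec m)) 18 (3 / 4) := by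
  have h1 := expLim_lam_expansion.mul expLim_pertQ
  have h2 := expLim_zero_of_le (s := 18) (by norm_num) (by norm_num) abs_pertQ_sub_pertR_sub_le
  have h3 := ((ExpLim.pow_self (show (9 : ℝ) ≠ 0 by norm_num)).const_mul 3).mul expLim_mainSum
  exact (((h1.cast (s := 18) (by norm_num) rfl (.of_forall fun _ => rfl)).add h2).add
    (h3.cast (s := 18) (by norm_num) rfl (.of_forall fun _ => rfl))).cast rfl (by norm_num)
    (.of_forall fun m => by ring)

theorem linD_newVec (m : ℕ) : linD (eulerian (2 * m)) (newVec m) =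
    2 * m * yChoice (2 * m) ^ 2 + 2 * yChoice (2 * m) * (e₁ (2 * m) - pertJ (devVec m)) +
      (ell₂ (2 * m) - 2 * pertQ (devVec m) + pertQQ (devVec m)) := by
  rw [newVec_eq, linD_one_sub]
  simp

theorem linN_newVec (m : ℕ) : linN (eulerian (2 * m)) (newVec m) =
    e₁ (2 * m) * yChoice (2 * m) ^ 2 + 2 * yChoice (2 * m) * (ell₂ (2 * m) - pertQ (devVec m)) +
      (ell₃ (2 * m) - 2 * pertR (devVec m) + pertRR (devVec m)) := by
  rw [newVec_eq, linN_one_sub]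
  simp

theorem expLim_linD : ExpLim (fun m => linD (eulerian (2 * m)) (newVec m)) 16 4 := by
  have hy := expLim_zero_of_nat_mul expLim_yChoice
  have t1 := ((expLim_yChoice.mul hy).const_mul 2).weaken (by norm_num)
    (show _ < (16 : ℝ) by norm_num)
  have t2 := ((hy.mul expLim_e₁).const_mul 2).weaken (by norm_num)
    (show _ < (16 : ℝ) by norm_num)
  have t3 := ((hy.mul expLim_pertJ).const_mul 2).weaken (by norm_num)
    (show _ < (16 : ℝ) by norm_num)
  have t4 := (expLim_pertQ.const_mul 2).weaken (by norm_num) (show _ < (16 : ℝ) by norm_num)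
  have t5 := expLim_pertQQ.weaken (by norm_num) (show _ < (16 : ℝ) by norm_num)
  refine (((((expLim_ell₂.add t1).add t2).sub t3).sub t4).add t5).cast rfl (by norm_num)
    (.of_forall fun m => ?_)
  rw [linD_newVec]; ring

theorem expLim_linN_sub : ExpLim (fun m => linN (eulerian (2 * m)) (newVec m) -
    lam (2 * m) * linD (eulerian (2 * m)) (newVec m)) 18 (3 / 2) := by
  -- The square term is negligible: nλ − e₁ has order m·4^m and y − y₀ tends to 0.
  have t1 := (((expLim_lam_gap.nat_mul (by norm_num) (show _ < (5 : ℝ) by norm_num)).mul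
    (expLim_yChoice_sub.mul expLim_yChoice_sub)).weaken (by norm_num)
    (show _ < (18 : ℝ) by norm_num))
  -- A borderline product, as (9/4)·8 = 18: it is o(18^m) only because y carries a factor 1/m, which
  -- is shifted here onto λJ − Q.
  have t2 := ((expLim_yChoice.mul expLim_lam_mul_pertJ_sub).const_mul 2).cast (s := 18)
    (by norm_num) rfl (.of_forall fun _ => rfl)
  have t3 := expLim_lam_mul_pertQ_sub.const_mul 2
  have t4 := (expLim_lam.mul expLim_pertQQ).cast (s := 18) (by norm_num) rfl
    (.of_forall fun _ => rfl)
  refine ((((t3.sub t1).add t2).add expLim_pertRR).sub t4).cast rfl (by norm_num) ?_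
  filter_upwards [eventually_ne_atTop 0, eventually_detA_pos, eventually_uni_disc_nonneg,
    eventually_lam_gap_pos] with m hm hA hd hg
  have hm' : (m : ℝ) ≠ 0 := Nat.cast_ne_zero.2 hm
  have hr := rayleigh_eq hA.ne' hd hg.ne' (yChoice (2 * m)) 1
  push_cast at hr
  rw [linD_newVec, linN_newVec]
  field_simp
  linear_combination hr

end EulerianRelaxation
end

/-! ### Conclusion: well-definedness for large m and the asymptotic quotient. -/

open EulerianRelaxation Filter Topology in
theorem mainTheorem1 :
    -- the choice of `y` and both bounds are well defined for large `m`
    (∀ᶠ m : ℕ in atTop, 0 < (critPoly (2 * m)).coeff 2 ∧ 0 ≤ critDisc (2 * m) ∧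
      0 < linD (eulerian (2 * m)) (newVec m) ∧ 0 < linN (eulerian (2 * m)) (newVec m) ∧
      0 < un (2 * m) ∧ IsLeast (uniRelaxation (2 * m)) (-1 / un (2 * m))) ∧
    Tendsto (fun m : ℕ => (multBound m - un (2 * m)) / (3 / 8 * (9 / 8 : ℝ) ^ m))
      atTop (𝓝 1) := by
  have hl := expLim_lam.eventually_pos (by norm_num) (by norm_num)
  have hD := expLim_linD.eventually_pos (by norm_num) (by norm_num)
  have hleast : ∀ᶠ m : ℕ in atTop, IsLeast (uniRelaxation (2 * m)) (-1 / lam (2 * m)) := by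
    filter_upwards [hl, eventually_detA_pos, eventually_uni_disc_nonneg, eventually_lam_gap_pos,
      eventually_gt_atTop 0] with m hl hA hd hg hm
    exact isLeast_uniRelaxation (by omega) hA hd hl hg
  have hun : ∀ᶠ m : ℕ in atTop, un (2 * m) = lam (2 * m) := by
    filter_upwards [hl, hleast] with m hl h
    exact un_eq_lam hl h
  constructor
  · filter_upwards [hl, hD, hleast, hun,
      eventually_pos_of_div expLim_critA (by norm_num) (by norm_num),
      eventually_disc_nonneg expLim_critA expLim_critB expLim_critC,
      expLim_linN_sub.eventually_pos (by norm_num) (by norm_num)]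
      with m hl hD hleast hun hA hd hN
    rw [(coeff_critPoly _).1, critDisc_eq, hun]
    have := mul_pos hl hD
    exact ⟨by linarith, by linarith, hD, by linarith, hl, hleast⟩
  -- The quotient (N(v) − λD(v))/D(v) has rate 18/16 = 9/8 and constant (3/2)/4 = 3/8, which 8/3
  -- normalizes to 1.
  · have h := (expLim_linN_sub.div expLim_linD (by norm_num)).const_mul (8 / 3)
    have h' : ExpLim (fun m => 8 / 3 * (multBound m - un (2 * m))) (9 / 8) 1 := by
      refine h.cast (by norm_num) (by norm_num) ?_
      filter_upwards [hun, hD] with m hun hD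
      rw [hun, multBound]
      field_simp
    refine Tendsto.congr (fun m => ?_) h'
    have : (9 / 8 : ℝ) ^ m ≠ 0 := by positivity
    field_simp
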